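/- Let $L\ge 1$ be a real number, let $D>0$, and let $\{X_n\}_{n\in\mathbb Z}$ be a zero-mean stationary Gaussian process with variance $\sigma_X^2$ whose power spectral density $S_X(\omega)=\sum_k \mathbb E(X_{n+k}X_n)e^{-j\omega k}$ vanishes for $\omega\in(-\pi,\pi]\setminus[-\pi/L,\pi/L]$. The sigma-delta test channel is defined as follows. Let $\{N_n\}$ be i.i.d. $\mathcal N(0,\sigma^2_{\Sigma\Delta})$ and independent of the process $\{X_n\}$; let $\{c_n\}$ be a real, square-summable, strictly causal impulse response ($c_n=0$ for $n\le 0$) with Fourier transform $C(\omega)=\sum_n c_n e^{-j\omega n}$ (in the $L^2$ sense); put $$U_n = X_n-(c*N)_n,\qquad \hat X_n=(h*(U+N))_n,$$ where $h$ is the impulse response of the ideal low-pass filter with $H(\omega)=1$ for $|\omega|\le\pi/L$ and $H(\omega)=0$ for $\pi/L<|\omega|\le\pi$, and the convolution sums are mean-square limits of symmetric partial sums. Suppose that the test channel attains the mean-squared error $\mathbb E(X_n-\hat X_n)^2=D$. Then for every $n$ the mutual information (in bits) between the input and the output of the additive Gaussian noise channel satisfies $$I(U_n;U_n+N_n)\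 \ge\ \frac1{2L}\log_2\Big(1+\frac{\sigma_X^2}{D}\Big),$$ with equality if and only if $$|1-C(\omega)|^2=\begin{cases}\big(1+\sigma_X^2/D\big)^{-(L-1)/L} & \text{for a.e. } \omega\in[-\pi/L,\pi/L]\cap(-\pi,\pi],\\[2pt] \big(1+\sigma_X^2/D\big)^{1/L} & \text{for a.e. }\omega\in(-\pi,\pi]\setminus[-\pi/L,\pi/L]\end{cases}$$ and $$\sigma^2_{\Sigma\Delta}=\frac{D}{\frac1{2\pi}\int_{-\pi/L}^{\pi/L}|1-C(\omega)|^2\,d\omega}=\frac{L\,D}{\big(1+\sigma_X^2/D\big)^{-(L-1)/L}}.$$ -/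

import Mathlib

open MeasureTheory ProbabilityTheory Filter Topology
open scoped NNReal ENNReal

namespace SigmaDelta

noncomputable section

/-- `Z = a * W`: for every time `n`, the random variable `Z n` is the mean-square limit of
`∑_{|k| ≤ K} a k * W (n - k)` as `K → ∞`. -/
def IsFilterOutput {Ω : Type*} [MeasurableSpace Ω] (P : Measure Ω)
    (a : ℤ → ℝ) (W Z : ℤ → Ω → ℝ) : Prop :=
  ∀ n : ℤ, MemLp (Z n) 2 P ∧
    Tendsto (fun K : ℕ => eLpNorm
      (fun x => (∑ k ∈ Finset.Icc (-(K : ℤ)) (K : ℤ), a k * W (n - k) x) - Z n x) 2 P)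
      atTop (𝓝 0)

/-- Strictly causal filters with square-summable impulse response. -/
structure IsStrictlyCausalFilter (c : ℤ → ℝ) : Prop where
  causal : ∀ k : ℤ, k ≤ 0 → c k = 0
  summable_sq : Summable (fun k : ℤ => c k ^ 2)

/-- `C` is (a version of) the Fourier transform `C(ω) = ∑ k, c k e^{-jωk}`, the series converging
in the mean square on `(-π, π]`. -/
def IsFourierTransform (c : ℤ → ℝ) (C : ℝ → ℂ) : Prop :=
  MemLp C 2 (volume.restrict (Set.Ioc (-Real.pi) Real.pi)) ∧
    Tendsto (fun K : ℕ => eLpNorm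
      (fun w : ℝ => (∑ k ∈ Finset.Icc (-(K : ℤ)) (K : ℤ),
        (c k : ℂ) * Complex.exp (-(Complex.I * (w : ℂ) * (k : ℂ)))) - C w)
      2 (volume.restrict (Set.Ioc (-Real.pi) Real.pi))) atTop (𝓝 0)

/-- Impulse response of the ideal low-pass filter: the inverse Fourier transform of
`H(ω) = 1` for `|ω| ≤ π/L`, `H(ω) = 0` for `π/L < |ω| ≤ π`. -/
def idealLowPass (L : ℝ) (k : ℤ) : ℝ :=
  1 / (2 * Real.pi) * ∫ w in (-(Real.pi / L))..(Real.pi / L), Real.cos ((k : ℝ) * w)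

/-- Autocorrelation function of a stationary zero-mean process. -/
def autocorrelation {Ω : Type*} [MeasurableSpace Ω] (P : Measure Ω) (X : ℤ → Ω → ℝ) (k : ℤ) : ℝ :=
  ∫ x, X k x * X 0 x ∂P

/-- `S` is the power spectral density with autocorrelation `R`: the integrable function on
`(-π, π]` with Fourier series `S(ω) = ∑ k, R k e^{-jωk}`. -/
def IsPSD (R : ℤ → ℝ) (S : ℝ → ℝ) : Prop :=
  IntegrableOn S (Set.Ioc (-Real.pi) Real.pi) ∧
    ∀ k : ℤ, (R k : ℂ) = 1 / (2 * (Real.pi : ℂ)) *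
      ∫ w in (-Real.pi)..Real.pi, (S w : ℂ) * Complex.exp (Complex.I * (w : ℂ) * (k : ℂ))

/-- Zero-mean stationary Gaussian processes with variance `varX` whose power spectral density
vanishes outside `[-π/L, π/L]`. -/
structure IsBandLimitedGaussian {Ω : Type*} [MeasurableSpace Ω] (P : Measure Ω)
    (L varX : ℝ) (X : ℤ → Ω → ℝ) : Prop where
  gaussian : IsGaussianProcess X P
  stationary : ∀ k : ℤ, IdentDistrib (fun x n => X (n + k) x) (fun x n => X n x) P P
  mean_zero : ∀ n : ℤ, ∫ x, X n x ∂P = 0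
  variance_eq : ∀ n : ℤ, variance (X n) P = varX
  band_limited : ∃ S : ℝ → ℝ, IsPSD (autocorrelation P X) S ∧
    ∀ w ∈ Set.Ioc (-Real.pi) Real.pi, w ∉ Set.Icc (-(Real.pi / L)) (Real.pi / L) → S w = 0

/-- Additive white Gaussian noise with variance `v`, independent of the process `X`. -/
structure IsAWGN {Ω : Type*} [MeasurableSpace Ω] (P : Measure Ω)
    (v : ℝ≥0) (X N : ℤ → Ω → ℝ) : Prop where
  law : ∀ n : ℤ, HasLaw (N n) (gaussianReal 0 v) P
  iid : iIndepFun N P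
  indep_input : IndepFun (fun x n => X n x) (fun x n => N n x) P

/-- The sigma-delta test channel: the noise `N` is fed back through the strictly causal filter `c`
and subtracted from the source `X`, giving the input `U` of the AWGN channel; the output `U + N` is
low-pass filtered, giving the reconstruction `Xhat`. -/
structure IsTestChannel {Ω : Type*} [MeasurableSpace Ω] (P : Measure Ω)
    (L : ℝ) (v : ℝ≥0) (c : ℤ → ℝ) (X N U Xhat : ℤ → Ω → ℝ) : Prop where
  filter : IsStrictlyCausalFilter c
  noise : IsAWGN P v X N
  feedback : ∃ F : ℤ → Ω → ℝ, IsFilterOutput P c N F ∧ ∀ n x, U n x = X n x - F n x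
  reconstruction : IsFilterOutput P (idealLowPass L) (fun n x => U n x + N n x) Xhat

/-- Mutual information of two real random variables, in bits. -/
def mutualInfo {Ω : Type*} [MeasurableSpace Ω] (P : Measure Ω) (A B : Ω → ℝ) : ℝ≥0∞ :=
  InformationTheory.klDiv (P.map (fun x => (A x, B x))) ((P.map A).prod (P.map B)) /
    ENNReal.ofReal (Real.log 2)

end

end SigmaDelta

/-! The channel output is U + N = X + (δ - c) * N: the feedback shapes the noise by the monic causal
filter 1 - C and leaves X untouched. The low-pass filter is 1 on the band carrying X, so the
distortion is the in-band shaped noise power, D = v · (1/2π) ∫_band |1 - C|². Since c 0 = 0, U_n and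
N_n are uncorrelated; being jointly Gaussian they are independent, and I(U_n; U_n + N_n) = ½ log₂(1
+ Var U_n / v). Eliminating varX / v by means of the distortion formula gives, with g = 1 + varX /
D, 2π (1 + Var U_n / v) = g ∫_band |1 - C|² + ∫_off-band |1 - C|².

Jensen's inequality for a monic causal filter says that log |1 - C|² has nonnegative mean over a
period. The weight, g on the band and 1 off it, has geometric mean g^(1/L), so the
arithmetic-geometric mean inequality bounds the weighted energy below by 2π g^(1/L), with equality
exactly when the weighted |1 - C|² is a.e. constant, equal to g^(1/L).

To avoid discussing log |1 - C| for a mere L² function, Jensen's inequality is used in a form linear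
in the modulus: ∫ |1 - C| r ≥ 2π for every bounded r > 0 with ∫ log r ≥ 0
(`two_pi_le_integral_norm_one_sub_mul`). This is proved for polynomials through the Mahler measure
and survives mean-square limits. `weighted_energy_lower_bound` then expands ∫ (|1 - C| r - 1)² ≥ 0,
which yields both the bound and the equality case.

The probabilistic half rests on `hasGaussianLaw_input_and_indepFun`, on `klDiv_gaussian_channel`,
and on `channel_second_moments`, where the isometry between a process and L² of its spectral measure
turns variances into frequency integrals. -/

namespace SigmaDelta

/-! ### Jensen's inequality for monic causal filters -/

/-- Partial Fourier sum `∑ k ∈ s, a k e^{-jωk}`. -/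
noncomputable def trigSum (s : Finset ℤ) (a : ℤ → ℂ) (w : ℝ) : ℂ :=
  ∑ k ∈ s, a k * Complex.exp (-(Complex.I * (w : ℂ) * (k : ℂ)))

lemma continuous_trigSum (s : Finset ℤ) (a : ℤ → ℂ) : Continuous (trigSum s a) := by
  unfold trigSum; fun_prop

/-- Both sides are the modulus of the leading coefficient times a product over the roots, and ‖α‖ ≤
max 1 ‖α‖ factor by factor. This is Jensen's inequality at the centre of the unit disc. -/
lemma norm_coeff_zero_le_mahlerMeasure (p : Polynomial ℂ) : ‖p.coeff 0‖ ≤ p.mahlerMeasure := by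
  rw [Polynomial.mahlerMeasure_eq_leadingCoeff_mul_prod_roots,
    (IsAlgClosed.splits p).coeff_zero_eq_leadingCoeff_mul_prod_roots]
  simp only [norm_mul, norm_pow, norm_neg, norm_one, one_pow, one_mul]
  gcongr
  have h : ‖p.roots.prod‖ = (p.roots.map fun a => ‖a‖).prod :=
    map_multiset_prod (normHom : ℂ →*₀ ℝ) p.roots
  rw [h]
  exact Multiset.prod_map_le_prod_map₀ _ _ (fun _ _ => norm_nonneg _) (fun _ _ => le_max_right _ _)

lemma integral_log_norm_eval (p : Polynomial ℂ) :
    IntegrableOn (fun w : ℝ => Real.log ‖p.eval (Complex.exp (-(Complex.I * w)))‖)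
      (Set.Ioc (-Real.pi) Real.pi) ∧
    ∫ w in Set.Ioc (-Real.pi) Real.pi, Real.log ‖p.eval (Complex.exp (-(Complex.I * w)))‖
      = 2 * Real.pi * p.logMahlerMeasure := by
  have hper : Function.Periodic (fun θ : ℝ => Real.log ‖p.eval (circleMap 0 1 θ)‖) (2 * Real.pi) :=
    fun θ => by simp only [periodic_circleMap 0 1 θ]
  have hint := p.intervalIntegrable_mahlerMeasure
  have hneg : ∀ w : ℝ, Real.log ‖p.eval (Complex.exp (-(Complex.I * w)))‖
      = (fun θ : ℝ => Real.log ‖p.eval (circleMap 0 1 θ)‖) (-w) := by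
    intro w; simp [circleMap, mul_comm]
  have hpi : -Real.pi ≤ Real.pi := by linarith [Real.pi_pos]
  have h2 : IntervalIntegrable (fun θ : ℝ => Real.log ‖p.eval (circleMap 0 1 θ)‖) volume
      Real.pi (-Real.pi) :=
    hper.intervalIntegrable (t := 0) Real.two_pi_pos.ne' (by simpa using hint) _ _
  constructor
  · rw [← intervalIntegrable_iff_integrableOn_Ioc_of_le hpi]
    simp_rw [hneg]
    have := (IntervalIntegrable.iff_comp_neg (by simp)).1 h2
    rwa [neg_neg] at this
  · rw [← intervalIntegral.integral_of_le hpi]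
    simp_rw [hneg]
    rw [intervalIntegral.integral_comp_neg (fun θ : ℝ => Real.log ‖p.eval (circleMap 0 1 θ)‖),
      neg_neg, Polynomial.logMahlerMeasure_def, Real.circleAverage]
    have := hper.intervalIntegral_add_eq (-Real.pi) 0
    rw [show -Real.pi + 2 * Real.pi = Real.pi by ring, zero_add] at this
    rw [this]
    have := Real.pi_pos
    simp; field_simp

/-- A polynomial has finitely many roots and w ↦ e^{-jw} is injective on (-π, π]. The fact is needed
because `Real.log 0 = 0` would spoil both log x ≤ x - 1 and the splitting of the logarithm of a
product. -/
lemma ae_eval_exp_ne_zero {p : Polynomial ℂ} (hp : p ≠ 0) :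
    ∀ᵐ w : ℝ ∂(volume.restrict (Set.Ioc (-Real.pi) Real.pi)),
      p.eval (Complex.exp (-(Complex.I * w))) ≠ 0 := by
  rw [ae_restrict_iff' measurableSet_Ioc]
  have hinj : Set.InjOn (fun w : ℝ => Complex.exp (-(Complex.I * w)))
      ((fun w : ℝ => Complex.exp (-(Complex.I * w))) ⁻¹' {z | p.IsRoot z} ∩
        Set.Ioc (-Real.pi) Real.pi) := by
    intro x hx y hy hxy
    simp only [Complex.exp_neg, inv_inj] at hxy
    have := Complex.exp_inj_of_neg_pi_lt_of_le_pi (x := Complex.I * x) (y := Complex.I * y)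
      (by simpa using hx.2.1) (by simpa using hx.2.2) (by simpa using hy.2.1)
      (by simpa using hy.2.2) hxy
    simpa using this
  have hfin : ((fun w : ℝ => Complex.exp (-(Complex.I * w))) ⁻¹' {z | p.IsRoot z} ∩
        Set.Ioc (-Real.pi) Real.pi).Finite := by
    refine Set.Finite.of_finite_image ((Polynomial.finite_setOfPred_isRoot hp).subset ?_) hinj
    rintro _ ⟨w, hw, rfl⟩
    exact hw.1
  filter_upwards [measure_eq_zero_iff_ae_notMem.1 (hfin.measure_zero volume)] with w hw hmem h0
  exact hw ⟨h0, hmem⟩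

/-- Jensen's inequality for polynomials, in weighted form. -/
lemma two_pi_le_integral_norm_eval_mul (p : Polynomial ℂ) (hp : p.coeff 0 = 1) {r : ℝ → ℝ} {M : ℝ}
    (hr : Measurable r) (hr0 : ∀ w, 0 < r w) (hrM : ∀ w, r w ≤ M)
    (hlog : IntegrableOn (fun w => Real.log (r w)) (Set.Ioc (-Real.pi) Real.pi))
    (hlog0 : 0 ≤ ∫ w in Set.Ioc (-Real.pi) Real.pi, Real.log (r w)) :
    2 * Real.pi ≤ ∫ w in Set.Ioc (-Real.pi) Real.pi,
      ‖p.eval (Complex.exp (-(Complex.I * w)))‖ * r w := by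
  have hp0 : p ≠ 0 := by rintro rfl; simp at hp
  obtain ⟨hint, hval⟩ := integral_log_norm_eval p
  have hM : 0 ≤ p.logMahlerMeasure := by
    rw [Polynomial.logMahlerMeasure_eq_log_MahlerMeasure]
    apply Real.log_nonneg
    simpa [hp] using norm_coeff_zero_le_mahlerMeasure p
  have hi1 : IntegrableOn (fun w : ℝ => ‖p.eval (Complex.exp (-(Complex.I * w)))‖ * r w)
      (Set.Ioc (-Real.pi) Real.pi) := by
    have hc : Continuous (fun w : ℝ => ‖p.eval (Complex.exp (-(Complex.I * w)))‖) := by fun_prop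
    refine Integrable.mul_bdd (c := M) (hc.integrableOn_Ioc) hr.aestronglyMeasurable
      (ae_of_all _ fun w => ?_)
    rw [Real.norm_eq_abs, abs_of_pos (hr0 w)]
    exact hrM w
  -- Integrate log x ≤ x - 1 at x = |p| r; the integrals of log |p| and log r are both nonnegative,
  -- which leaves the 2π coming from the constant 1.
  have hle : ∫ w in Set.Ioc (-Real.pi) Real.pi,
      (Real.log ‖p.eval (Complex.exp (-(Complex.I * w)))‖ + Real.log (r w) + 1) ≤
      ∫ w in Set.Ioc (-Real.pi) Real.pi, ‖p.eval (Complex.exp (-(Complex.I * w)))‖ * r w := by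
    refine integral_mono_ae ((hint.add hlog).add (integrable_const _)) hi1 ?_
    filter_upwards [ae_eval_exp_ne_zero hp0] with w hw
    have h1 := norm_pos_iff.2 hw
    have := Real.log_le_sub_one_of_pos (mul_pos h1 (hr0 w))
    rw [Real.log_mul h1.ne' (hr0 w).ne'] at this
    linarith
  refine le_trans ?_ hle
  rw [integral_add (by exact hint.add hlog) (integrable_const _), integral_add hint hlog, hval]
  have : ∫ w in Set.Ioc (-Real.pi) Real.pi, (1:ℝ) = 2 * Real.pi := by
    simp [Real.pi_pos.le]; ring
  rw [this]
  have := mul_nonneg Real.two_pi_pos.le hM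
  linarith

lemma exists_polynomial_eval_eq {c : ℤ → ℝ} (hc : ∀ k ≤ 0, c k = 0) (s : Finset ℤ) :
    ∃ p : Polynomial ℂ, p.coeff 0 = 1 ∧ ∀ w : ℝ,
      p.eval (Complex.exp (-(Complex.I * w))) = 1 - trigSum s (fun k => (c k : ℂ)) w := by
  -- By causality the truncated transfer function is a polynomial in z = e^{-jω}. `toNat` sends
  -- every k ≤ 0 to exponent 0, but there the coefficient c k vanishes.
  refine ⟨1 - ∑ k ∈ s, Polynomial.C (c k : ℂ) * Polynomial.X ^ k.toNat, ?_, fun w => ?_⟩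
  · simp only [Polynomial.coeff_sub, Polynomial.coeff_one_zero, Polynomial.finsetSum_coeff,
      Polynomial.coeff_C_mul, Polynomial.coeff_X_pow]
    rw [sub_eq_self]
    refine Finset.sum_eq_zero fun k _ => ?_
    rcases le_or_gt k 0 with hk | hk
    · simp [hc k hk]
    · rw [if_neg (by omega), mul_zero]
  · simp only [Polynomial.eval_sub, Polynomial.eval_one, Polynomial.eval_finsetSum,
      Polynomial.eval_mul, Polynomial.eval_C, Polynomial.eval_pow, Polynomial.eval_X, trigSum]
    congr 1
    refine Finset.sum_congr rfl fun k _ => ?_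
    rcases le_or_gt k 0 with hk | hk
    · simp [hc k hk]
    · rw [← Complex.exp_nat_mul]
      congr 2
      obtain ⟨n, rfl⟩ := Int.eq_ofNat_of_zero_le hk.le
      simp; ring

/-- Jensen's inequality for the transfer function `1 - C` of a monic causal filter, in weighted
form. -/
lemma two_pi_le_integral_norm_one_sub_mul {c : ℤ → ℝ} {C : ℝ → ℂ} (hc : ∀ k ≤ 0, c k = 0)
    (hC : IsFourierTransform c C) {r : ℝ → ℝ} {M : ℝ}
    (hr : Measurable r) (hr0 : ∀ w, 0 < r w) (hrM : ∀ w, r w ≤ M)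
    (hlog : IntegrableOn (fun w => Real.log (r w)) (Set.Ioc (-Real.pi) Real.pi))
    (hlog0 : 0 ≤ ∫ w in Set.Ioc (-Real.pi) Real.pi, Real.log (r w)) :
    2 * Real.pi ≤ ∫ w in Set.Ioc (-Real.pi) Real.pi, ‖1 - C w‖ * r w := by
  set lam := volume.restrict (Set.Ioc (-Real.pi) Real.pi) with hlam
  let T : ℕ → ℝ → ℂ := fun K => trigSum (Finset.Icc (-(K : ℤ)) K) (fun k => (c k : ℂ))
  have hTc : ∀ K, Continuous (T K) := fun K => continuous_trigSum _ _
  have hr' : ∀ᵐ w ∂lam, ‖r w‖ ≤ M := ae_of_all _ fun w => by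
    rw [Real.norm_eq_abs, abs_of_pos (hr0 w)]; exact hrM w
  have hCi : Integrable C lam := hC.1.integrable (by norm_num)
  have hfi : Integrable (fun w => ‖1 - C w‖ * r w) lam :=
    ((integrable_const _).sub hCi).norm.mul_bdd hr.aestronglyMeasurable hr'
  have hFi : ∀ K, Integrable (fun w => ‖1 - T K w‖ * r w) lam := fun K =>
    ((integrable_const _).sub ((hTc K).integrableOn_Ioc)).norm.mul_bdd
      hr.aestronglyMeasurable hr'
  -- On a finite measure, L² convergence of the partial sums implies L¹ convergence. That suffices,
  -- since the integrand is M-Lipschitz in the partial sum.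
  have hL1 : Tendsto (fun K => eLpNorm (fun w => T K w - C w) 1 lam) atTop (𝓝 0) := by
    have h2 : Tendsto (fun K => eLpNorm (fun w => T K w - C w) 2 lam *
        lam Set.univ ^ (1 / 2 : ℝ)) atTop (𝓝 0) := by
      have := ENNReal.Tendsto.mul_const (b := lam Set.univ ^ (1 / 2 : ℝ)) hC.2
        (Or.inr (ENNReal.rpow_ne_top_of_nonneg (by norm_num) (measure_ne_top _ _)))
      simpa [T, trigSum] using this
    refine tendsto_of_tendsto_of_tendsto_of_le_of_le tendsto_const_nhds h2 (fun _ => zero_le) ?_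
    intro K
    have := eLpNorm_le_eLpNorm_mul_rpow_measure_univ (p := 1) (q := 2) (by norm_num)
      (((hTc K).aestronglyMeasurable (μ := lam)).sub hC.1.1)
    norm_num at this
    exact this
  have hlim : Tendsto (fun K => ∫ w, ‖1 - T K w‖ * r w ∂lam) atTop
      (𝓝 (∫ w, ‖1 - C w‖ * r w ∂lam)) := by
    refine tendsto_integral_of_L1' _ hfi.1 (Eventually.of_forall hFi) ?_
    have h2 : Tendsto (fun K => ENNReal.ofReal M * eLpNorm (fun w => T K w - C w) 1 lam)
        atTop (𝓝 0) := by
      simpa using ENNReal.Tendsto.const_mul hL1 (Or.inr ENNReal.ofReal_ne_top)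
    refine tendsto_of_tendsto_of_tendsto_of_le_of_le tendsto_const_nhds h2 (fun _ => zero_le) ?_
    intro K
    refine eLpNorm_le_mul_eLpNorm_of_ae_le_mul (ae_of_all _ fun w => ?_) 1
    simp only [Pi.sub_apply]
    rw [← sub_mul, norm_mul, mul_comm, Real.norm_eq_abs (r w), abs_of_pos (hr0 w)]
    refine mul_le_mul (hrM w) ?_ (norm_nonneg _) ((hr0 w).le.trans (hrM w))
    · refine (abs_norm_sub_norm_le _ _).trans (le_of_eq ?_)
      rw [← norm_neg]; congr 1; ring
  refine ge_of_tendsto hlim (Eventually.of_forall fun K => ?_)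
  obtain ⟨p, hp0, hp⟩ := exists_polynomial_eval_eq hc (Finset.Icc (-(K : ℤ)) K)
  have := two_pi_le_integral_norm_eval_mul p hp0 hr hr0 hrM hlog hlog0
  simpa only [hp] using this


/-! ### Minimal weighted energy of a monic causal filter -/

lemma band_subset {L : ℝ} (hL : 1 ≤ L) :
    Set.Ioc (-(Real.pi / L)) (Real.pi / L) ⊆ Set.Ioc (-Real.pi) Real.pi := by
  have : Real.pi / L ≤ Real.pi := div_le_self Real.pi_pos.le hL
  exact Set.Ioc_subset_Ioc (by linarith) this

lemma setIntegral_indicator_band {E : Type*} [NormedAddCommGroup E] [NormedSpace ℝ E] {L : ℝ}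
    (hL : 1 ≤ L) (f : ℝ → E) :
    ∫ w in Set.Ioc (-Real.pi) Real.pi,
      (Set.Icc (-(Real.pi / L)) (Real.pi / L)).indicator f w =
    ∫ w in (-(Real.pi / L))..(Real.pi / L), f w := by
  have hpos : 0 ≤ Real.pi / L := by have := Real.pi_pos; positivity
  rw [intervalIntegral.integral_of_le (by linarith), setIntegral_indicator measurableSet_Icc]
  refine setIntegral_congr_set ?_
  have h1 : (Set.Icc (-(Real.pi / L)) (Real.pi / L) : Set ℝ) =ᵐ[volume]
    Set.Ioc (-(Real.pi / L)) (Real.pi / L) := Ioc_ae_eq_Icc.symm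
  have h2 := (ae_eq_refl (Set.Ioc (-Real.pi) Real.pi)).inter h1
  rwa [Set.inter_eq_self_of_subset_right (band_subset hL)] at h2

/-- Minimal output power of a monic causal filter, under the spectral weight `g` on the band and
`1` off the band. -/
lemma weighted_energy_lower_bound {L g : ℝ} (hL : 1 ≤ L) (hg : 0 < g) {c : ℤ → ℝ} {C : ℝ → ℂ}
    (hc : ∀ k ≤ 0, c k = 0) (hC : IsFourierTransform c C) :
    2 * Real.pi * g ^ (1 / L) ≤
      (g - 1) * (∫ w in (-(Real.pi / L))..(Real.pi / L), ‖1 - C w‖ ^ 2) +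
        ∫ w in Set.Ioc (-Real.pi) Real.pi, ‖1 - C w‖ ^ 2 ∧
    (2 * Real.pi * g ^ (1 / L) =
      (g - 1) * (∫ w in (-(Real.pi / L))..(Real.pi / L), ‖1 - C w‖ ^ 2) +
        ∫ w in Set.Ioc (-Real.pi) Real.pi, ‖1 - C w‖ ^ 2 ↔
      ∀ᵐ w ∂(volume.restrict (Set.Ioc (-Real.pi) Real.pi)),
          (w ∈ Set.Icc (-(Real.pi / L)) (Real.pi / L) → ‖1 - C w‖ ^ 2 = g ^ (-(L - 1) / L)) ∧
          (w ∉ Set.Icc (-(Real.pi / L)) (Real.pi / L) → ‖1 - C w‖ ^ 2 = g ^ (1 / L))) := by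
  classical
  have hL0 : 0 < L := by linarith
  have hpi := Real.pi_pos
  set lam := volume.restrict (Set.Ioc (-Real.pi) Real.pi) with hlam
  set B := Set.Icc (-(Real.pi / L)) (Real.pi / L) with hB
  have hBm : MeasurableSet B := measurableSet_Icc
  -- q normalises the weight to geometric mean 1: the band fills a fraction 1/L of the period, so
  -- log r, with r² = q · weight, integrates to 0.
  set q : ℝ := g ^ (-(1 / L)) with hq
  have hq0 : 0 < q := Real.rpow_pos_of_pos hg _
  have hqinv : q * g ^ (1 / L) = 1 := by
    rw [hq, ← Real.rpow_add hg]; simp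
  let r : ℝ → ℝ := fun w => if w ∈ B then √(g * q) else √q
  have hr : Measurable r := Measurable.ite hBm measurable_const measurable_const
  have hr0 : ∀ w, 0 < r w := fun w => by
    by_cases h : w ∈ B <;> simp only [r, h, if_true, if_false] <;> positivity
  have hrM : ∀ w, r w ≤ √(g * q) + √q := fun w => by
    by_cases h : w ∈ B <;> simp only [r, h, if_true, if_false] <;>
      linarith [Real.sqrt_nonneg (g * q), Real.sqrt_nonneg q]
  have hr2 : ∀ w, r w ^ 2 = q * (1 + B.indicator (fun _ => g - 1) w) := fun w => by
    by_cases h : w ∈ B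
    · simp only [r, h, if_true, Set.indicator_of_mem]
      rw [Real.sq_sqrt (by positivity)]; ring
    · simp only [r, h, if_false, Set.indicator_of_notMem, not_false_eq_true]
      rw [Real.sq_sqrt (by positivity)]; ring
  have hlogr : (fun w => Real.log (r w)) = fun w =>
      (-(1 / L) * Real.log g) / 2 + B.indicator (fun _ => Real.log g / 2) w := by
    have hlq : Real.log q = -(1 / L) * Real.log g := Real.log_rpow hg _
    funext w
    by_cases h : w ∈ B
    · simp only [r, h, if_true, Set.indicator_of_mem]
      rw [Real.log_sqrt (by positivity), Real.log_mul hg.ne' hq0.ne', hlq]; ring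
    · simp only [r, h, if_false, Set.indicator_of_notMem, not_false_eq_true]
      rw [Real.log_sqrt (by positivity), hlq]; ring
  have hindi : Integrable (B.indicator (fun _ => Real.log g / 2)) lam :=
    (integrable_const _).indicator hBm
  have hlogi : Integrable (fun w => Real.log (r w)) lam := by
    rw [hlogr]; exact (integrable_const _).add hindi
  have hlog0 : 0 ≤ ∫ w, Real.log (r w) ∂lam := by
    rw [hlogr, integral_add (integrable_const _) hindi, hlam, hB,
      setIntegral_indicator_band hL]
    simp [hpi.le]
    field_simp
    ring_nf
    rfl
  have hjensen := two_pi_le_integral_norm_one_sub_mul hc hC hr hr0 hrM hlogi hlog0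
  set ψ : ℝ → ℝ := fun w => ‖1 - C w‖ * r w with hψ
  have hCm : MemLp (fun w => ‖1 - C w‖) 2 lam := (memLp_const (1 : ℂ) |>.sub hC.1).norm
  have hai : Integrable (fun w => ‖1 - C w‖ ^ 2) lam := hCm.integrable_sq
  have haB : Integrable (B.indicator (fun w => (g - 1) * ‖1 - C w‖ ^ 2)) lam :=
    (hai.const_mul _).indicator hBm
  have hψsq : ∀ w, ψ w ^ 2 =
      q * (‖1 - C w‖ ^ 2 + B.indicator (fun w => (g - 1) * ‖1 - C w‖ ^ 2) w) := fun w => by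
    rw [hψ, mul_pow, hr2]
    by_cases h : w ∈ B
    · simp only [h, Set.indicator_of_mem]; ring
    · simp only [h, Set.indicator_of_notMem, not_false_eq_true]; ring
  have hψ2i : Integrable (fun w => ψ w ^ 2) lam := by
    simp_rw [hψsq]; exact (hai.add haB).const_mul _
  have hψi : Integrable ψ lam := by
    refine (hCm.integrable (by norm_num)).mul_bdd (c := √(g * q) + √q) hr.aestronglyMeasurable
      (ae_of_all _ fun w => ?_)
    rw [Real.norm_eq_abs, abs_of_pos (hr0 w)]; exact hrM w
  have hE : ∫ w, ψ w ^ 2 ∂lam = q * ((g - 1) *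
      (∫ w in (-(Real.pi / L))..(Real.pi / L), ‖1 - C w‖ ^ 2) + ∫ w, ‖1 - C w‖ ^ 2 ∂lam) := by
    simp_rw [hψsq]
    rw [integral_const_mul, integral_add hai haB, hlam, hB, setIntegral_indicator_band hL,
      intervalIntegral.integral_const_mul]
    ring
  set E := (g - 1) * (∫ w in (-(Real.pi / L))..(Real.pi / L), ‖1 - C w‖ ^ 2) +
    ∫ w, ‖1 - C w‖ ^ 2 ∂lam with hEdef
  have hone : ∫ w, (1 : ℝ) ∂lam = 2 * Real.pi := by
    simp [hlam, hpi.le]; ring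
  have hsqi : Integrable (fun w => (ψ w - 1) ^ 2) lam := by
    have : (fun w => (ψ w - 1) ^ 2) = fun w => ψ w ^ 2 - 2 * ψ w + 1 := by funext w; ring
    rw [this]; exact (hψ2i.sub (hψi.const_mul _)).add (integrable_const _)
  -- Completing the square: with ∫ ψ ≥ 2π, nonnegativity forces q E ≥ 2π. If q E = 2π, the integral
  -- is at most 0, so ψ = 1 a.e.
  have hsq : ∫ w, (ψ w - 1) ^ 2 ∂lam = q * E - 2 * (∫ w, ψ w ∂lam) + 2 * Real.pi := by
    have : (fun w => (ψ w - 1) ^ 2) = fun w => ψ w ^ 2 - 2 * ψ w + 1 := by funext w; ring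
    rw [this, integral_add (by exact hψ2i.sub (hψi.const_mul _)) (integrable_const _),
      integral_sub hψ2i (hψi.const_mul _), integral_const_mul, hE, hone]
  have hsq0 : 0 ≤ ∫ w, (ψ w - 1) ^ 2 ∂lam := integral_nonneg fun w => sq_nonneg _
  have hiff : ∀ x y : ℝ, q * x ≤ q * y ↔ x ≤ y := fun x y => mul_le_mul_iff_right₀ hq0
  have hqT : q * (2 * Real.pi * g ^ (1 / L)) = 2 * Real.pi := by
    rw [mul_left_comm, hqinv, mul_one]
  have hpt : ∀ w, ψ w = 1 ↔ ((w ∈ B → ‖1 - C w‖ ^ 2 = g ^ (-(L - 1) / L)) ∧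
      (w ∉ B → ‖1 - C w‖ ^ 2 = g ^ (1 / L))) := by
    intro w
    have h1 : ψ w = 1 ↔ ψ w ^ 2 = 1 := by
      have : 0 ≤ ψ w := mul_nonneg (norm_nonneg _) (hr0 w).le
      exact (pow_eq_one_iff_of_nonneg this two_ne_zero).symm
    rw [h1, hψsq]
    by_cases h : w ∈ B
    · simp only [h, Set.indicator_of_mem, true_implies, not_true, false_implies, and_true]
      have h2 : g * q * g ^ (-(L - 1) / L) = 1 := by
        nth_rewrite 1 [← Real.rpow_one g]
        rw [hq, ← Real.rpow_add hg, ← Real.rpow_add hg]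
        rw [show (1 + -(1 / L) + -(L - 1) / L) = 0 by field_simp; ring, Real.rpow_zero]
      rw [show q * (‖1 - C w‖ ^ 2 + (g - 1) * ‖1 - C w‖ ^ 2) = g * q * ‖1 - C w‖ ^ 2 by ring]
      conv_lhs => rw [← h2]
      exact mul_right_inj' (mul_pos hg hq0).ne'
    · simp only [h, Set.indicator_of_notMem, not_false_eq_true, true_implies, false_implies,
        true_and, add_zero]
      conv_lhs => rw [← hqinv]
      exact mul_right_inj' hq0.ne'
  refine ⟨?_, ?_, ?_⟩
  · rw [← hiff, hqT]; linarith
  · intro h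
    have h0 : ∫ w, (ψ w - 1) ^ 2 ∂lam = 0 := by
      refine le_antisymm ?_ hsq0
      rw [hsq, ← h, hqT]; linarith
    rw [integral_eq_zero_iff_of_nonneg (fun w => sq_nonneg _) hsqi] at h0
    filter_upwards [h0] with w hw
    rw [← hpt]
    have : ψ w - 1 = 0 := by simpa using hw
    linarith
  · intro h
    have h1 : ∫ w, ψ w ^ 2 ∂lam = 2 * Real.pi := by
      rw [← hone]
      refine integral_congr_ae ?_
      filter_upwards [h] with w hw
      rw [(hpt w).2 hw]; norm_num
    rw [← mul_right_inj' hq0.ne', hqT, ← h1, hE]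


/-! ### Mutual information of the additive Gaussian noise channel -/

lemma integral_sq_gaussianReal (v : ℝ≥0) :
    Integrable (fun x : ℝ => x ^ 2) (gaussianReal 0 v) ∧ ∫ x, x ^ 2 ∂(gaussianReal 0 v) = v := by
  have h : MemLp (id : ℝ → ℝ) 2 (gaussianReal 0 v) := memLp_id_gaussianReal 2
  refine ⟨h.integrable_sq, ?_⟩
  have h1 := variance_eq_sub h
  rw [variance_id_gaussianReal] at h1
  simpa using h1.symm

variable {Ω : Type*} [MeasurableSpace Ω] {P : Measure Ω} [IsProbabilityMeasure P]

/-- Given U = u, the output has the noise density translated by u; dividing by the output density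
gives the density relative to the product of the marginals. Only the variances v and s + v must be
nonzero, so a degenerate input s = 0 is covered. -/
lemma map_prodMk_add_eq_withDensity {U N : Ω → ℝ} (hU : AEMeasurable U P) (hN : AEMeasurable N P)
    {s v : ℝ≥0} (hUlaw : P.map U = gaussianReal 0 s) (hNlaw : P.map N = gaussianReal 0 v)
    (hv : v ≠ 0) (hind : IndepFun U N P) :
    P.map (fun x => (U x, U x + N x)) =
      ((gaussianReal 0 s).prod (gaussianReal 0 (s + v))).withDensity
        (fun p => ENNReal.ofReal (gaussianPDFReal 0 v (p.2 - p.1) /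
          gaussianPDFReal 0 (s + v) p.2)) := by
  have hsv : s + v ≠ 0 := by simp [hv]
  have hρ : Measurable (fun p : ℝ × ℝ => ENNReal.ofReal (gaussianPDFReal 0 v (p.2 - p.1) /
          gaussianPDFReal 0 (s + v) p.2)) := by fun_prop
  have hmap : P.map (fun x => (U x, U x + N x)) =
      ((gaussianReal 0 s).prod (gaussianReal 0 v)).map (fun p => (p.1, p.1 + p.2)) := by
    rw [← hUlaw, ← hNlaw, ← (indepFun_iff_map_prod_eq_prod_map_map hU hN).1 hind,
      AEMeasurable.map_map_of_aemeasurable (by fun_prop) (by fun_prop)]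
    rfl
  rw [hmap]
  ext A hA
  rw [Measure.map_apply (by fun_prop) hA, withDensity_apply _ hA,
    Measure.prod_apply (by measurability), ← lintegral_indicator hA,
    lintegral_prod _ (by fun_prop)]
  refine lintegral_congr fun u => ?_
  rw [gaussianReal_of_var_ne_zero _ hv, gaussianReal_of_var_ne_zero _ hsv,
    lintegral_withDensity_eq_lintegral_mul _ (measurable_gaussianPDF _ _) (by fun_prop),
    withDensity_apply _ (by measurability), ← lintegral_indicator (by measurability),
    ← lintegral_sub_right_eq_self _ u]
  refine lintegral_congr fun y => ?_
  by_cases h : (u, y) ∈ A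
  · have h' : (y - u) ∈ (Prod.mk u ⁻¹' ((fun p : ℝ × ℝ => (p.1, p.1 + p.2)) ⁻¹' A)) := by
      simpa using h
    rw [Set.indicator_of_mem h', Pi.mul_apply, Set.indicator_of_mem h, gaussianPDF, gaussianPDF,
      ← ENNReal.ofReal_mul (gaussianPDFReal_nonneg _ _ _),
      mul_div_cancel₀ _ (gaussianPDFReal_pos _ _ _ hsv).ne']
  · have h' : (y - u) ∉ (Prod.mk u ⁻¹' ((fun p : ℝ × ℝ => (p.1, p.1 + p.2)) ⁻¹' A)) := by
      simpa using h
    rw [Set.indicator_of_notMem h', Pi.mul_apply, Set.indicator_of_notMem h, mul_zero]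

lemma log_gaussianPDFReal {v : ℝ≥0} (hv : v ≠ 0) (x : ℝ) :
    Real.log (gaussianPDFReal 0 v x) = -(Real.log (2 * Real.pi * v)) / 2 - x ^ 2 / (2 * v) := by
  have hv' : (0 : ℝ) < v := by positivity
  have := Real.pi_pos
  rw [gaussianPDFReal, Real.log_mul (by positivity) (by positivity), Real.log_exp, Real.log_inv,
    Real.log_sqrt (by positivity)]
  simp; ring

/-- Relative entropy between the joint law and the product of the marginals for the input and the
output of an additive Gaussian noise channel with Gaussian input. -/
lemma klDiv_gaussian_channel {U N : Ω → ℝ} (hU : AEMeasurable U P) (hN : AEMeasurable N P)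
    {s v : ℝ≥0} (hUlaw : P.map U = gaussianReal 0 s) (hNlaw : P.map N = gaussianReal 0 v)
    (hv : v ≠ 0) (hind : IndepFun U N P) :
    InformationTheory.klDiv (P.map (fun x => (U x, U x + N x)))
      ((P.map U).prod (P.map (fun x => U x + N x))) =
      ENNReal.ofReal (1 / 2 * Real.log (1 + s / v)) := by
  have hsv : s + v ≠ 0 := by simp [hv]
  have hv0 : (0 : ℝ) < v := by positivity
  have hYlaw : P.map (fun x => U x + N x) = gaussianReal 0 (s + v) := by
    have := gaussianReal_add_gaussianReal_of_indepFun hind hUlaw hNlaw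
    rwa [zero_add] at this
  have hY : AEMeasurable (fun x => U x + N x) P := hU.add hN
  have hpair : AEMeasurable (fun x => (U x, U x + N x)) P := hU.prodMk hY
  have hdens := map_prodMk_add_eq_withDensity hU hN hUlaw hNlaw hv hind
  rw [hUlaw, hYlaw]
  set ν := (gaussianReal 0 s).prod (gaussianReal 0 (s + v)) with hν
  set μ := P.map (fun x => (U x, U x + N x)) with hμ
  have hρ : Measurable (fun p : ℝ × ℝ => ENNReal.ofReal (gaussianPDFReal 0 v (p.2 - p.1) /
          gaussianPDFReal 0 (s + v) p.2)) := by fun_prop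
  have hac : μ ≪ ν := by rw [hdens]; exact withDensity_absolutelyContinuous _ _
  have : IsProbabilityMeasure μ := Measure.isProbabilityMeasure_map hpair
  -- The log-density is a constant plus two quadratic terms. Their means are -1/2 and 1/2, because E
  -- N² = v and E (U + N)² = s + v, so only the constant contributes to the divergence.
  have hllr : llr μ ν =ᵐ[μ] fun p => (Real.log (1 + s / v)) / 2 - (p.2 - p.1) ^ 2 / (2 * v) +
      p.2 ^ 2 / (2 * (s + v : ℝ)) := by
    have h1 : μ.rnDeriv ν =ᵐ[ν] fun p => ENNReal.ofReal (gaussianPDFReal 0 v (p.2 - p.1) /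
        gaussianPDFReal 0 (s + v) p.2) := by
      rw [hdens]; exact Measure.rnDeriv_withDensity ν hρ
    filter_upwards [hac.ae_le h1] with p hp
    have h2 := gaussianPDFReal_pos 0 v (p.2 - p.1) hv
    have h3 := gaussianPDFReal_pos 0 (s + v) p.2 hsv
    rw [llr, hp, ENNReal.toReal_ofReal (by positivity), Real.log_div h2.ne' h3.ne',
      log_gaussianPDFReal hv, log_gaussianPDFReal hsv,
      show (1 + s / v : ℝ) = (2 * Real.pi * (s + v)) / (2 * Real.pi * v) by
        have := Real.pi_pos; field_simp; ring,
      Real.log_div (by have := Real.pi_pos; positivity) (by have := Real.pi_pos; positivity)]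
    push_cast
    ring
  have hN2 : Integrable (fun x => N x ^ 2) P ∧ ∫ x, N x ^ 2 ∂P = v := by
    obtain ⟨h1, h2⟩ := integral_sq_gaussianReal v
    rw [← hNlaw] at h1 h2
    exact ⟨h1.comp_aemeasurable hN, by rwa [integral_map hN (by fun_prop)] at h2⟩
  have hY2 : Integrable (fun x => (U x + N x) ^ 2) P ∧
      ∫ x, (U x + N x) ^ 2 ∂P = ((s + v : ℝ≥0) : ℝ) := by
    obtain ⟨h1, h2⟩ := integral_sq_gaussianReal (s + v)
    rw [← hYlaw] at h1 h2
    exact ⟨h1.comp_aemeasurable hY, by rwa [integral_map hY (by fun_prop)] at h2⟩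
  have hint : Integrable (fun p : ℝ × ℝ => (Real.log (1 + s / v)) / 2 -
      (p.2 - p.1) ^ 2 / (2 * v) + p.2 ^ 2 / (2 * (s + v : ℝ))) μ := by
    rw [hμ, integrable_map_measure (by fun_prop) hpair]
    refine ((integrable_const _).sub ?_).add (hY2.1.div_const _)
    simpa using hN2.1.div_const (2 * (v : ℝ))
  rw [InformationTheory.klDiv_of_ac_of_integrable hac (hint.congr hllr.symm),
    integral_congr_ae hllr]
  congr 1
  rw [probReal_univ, probReal_univ, hμ, integral_map hpair (by fun_prop)]
  simp only [add_sub_cancel_left]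
  rw [integral_add (by exact (integrable_const _).sub (hN2.1.div_const _)) (hY2.1.div_const _),
    integral_sub (integrable_const _) (hN2.1.div_const _), integral_div (2 * (v : ℝ)),
    integral_div (2 * (s + v : ℝ)), hN2.2, hY2.2]
  simp
  field_simp
  ring


/-! ### Mean-square limits, joint Gaussianity and independence -/

lemma tendsto_integral_mul_conj {α 𝕜 : Type*} [RCLike 𝕜] [MeasurableSpace α] {μ : Measure α}
    {f g : ℕ → α → 𝕜} {f' g' : α → 𝕜} (hf : ∀ K, MemLp (f K) 2 μ) (hf' : MemLp f' 2 μ)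
    (hg : ∀ K, MemLp (g K) 2 μ) (hg' : MemLp g' 2 μ)
    (hff : Tendsto (fun K => eLpNorm (fun x => f K x - f' x) 2 μ) atTop (𝓝 0))
    (hgg : Tendsto (fun K => eLpNorm (fun x => g K x - g' x) 2 μ) atTop (𝓝 0)) :
    Tendsto (fun K => ∫ x, f K x * (starRingEnd 𝕜) (g K x) ∂μ) atTop
      (𝓝 (∫ x, f' x * (starRingEnd 𝕜) (g' x) ∂μ)) := by
  have key : ∀ {u v : α → 𝕜} (hu : MemLp u 2 μ) (hv : MemLp v 2 μ),
      inner 𝕜 (hv.toLp v) (hu.toLp u) = ∫ x, u x * (starRingEnd 𝕜) (v x) ∂μ := by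
    intro u v hu hv
    rw [L2.inner_def]
    refine integral_congr_ae ?_
    filter_upwards [hu.coeFn_toLp, hv.coeFn_toLp] with x hx hy
    rw [hx, hy, RCLike.inner_apply]
  have h1 : Tendsto (fun K => (hf K).toLp (f K)) atTop (𝓝 (hf'.toLp f')) :=
    (Lp.tendsto_Lp_iff_tendsto_eLpNorm'' _ hf _ hf').2 hff
  have h2 : Tendsto (fun K => (hg K).toLp (g K)) atTop (𝓝 (hg'.toLp g')) :=
    (Lp.tendsto_Lp_iff_tendsto_eLpNorm'' _ hg _ hg').2 hgg
  have := h2.inner (𝕜 := 𝕜) h1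
  simpa only [key] using this

section Probability

variable {Ω : Type*} [MeasurableSpace Ω] {P : Measure Ω} [IsProbabilityMeasure P]

omit [IsProbabilityMeasure P] in
lemma tendsto_integral_mul {f g : ℕ → Ω → ℝ} {f' g' : Ω → ℝ}
    (hf : ∀ K, MemLp (f K) 2 P) (hf' : MemLp f' 2 P)
    (hg : ∀ K, MemLp (g K) 2 P) (hg' : MemLp g' 2 P)
    (hff : Tendsto (fun K => eLpNorm (fun x => f K x - f' x) 2 P) atTop (𝓝 0))
    (hgg : Tendsto (fun K => eLpNorm (fun x => g K x - g' x) 2 P) atTop (𝓝 0)) :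
    Tendsto (fun K => ∫ x, f K x * g K x ∂P) atTop (𝓝 (∫ x, f' x * g' x ∂P)) := by
  simpa using tendsto_integral_mul_conj (𝕜 := ℝ) hf hf' hg hg' hff hgg

lemma tendsto_eLpNorm_one {f : ℕ → Ω → ℝ} {f' : Ω → ℝ}
    (hf : ∀ K, MemLp (f K) 2 P) (hf' : MemLp f' 2 P)
    (hff : Tendsto (fun K => eLpNorm (fun x => f K x - f' x) 2 P) atTop (𝓝 0)) :
    Tendsto (fun K => eLpNorm (fun x => f K x - f' x) 1 P) atTop (𝓝 0) :=
  tendsto_of_tendsto_of_tendsto_of_le_of_le tendsto_const_nhds hff (fun _ => zero_le) fun K =>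
    eLpNorm_le_eLpNorm_of_exponent_le (by norm_num) ((hf K).1.sub hf'.1)

/-- Gaussian laws on the line are closed under mean-square limits. -/
lemma hasGaussianLaw_of_tendsto {f : ℕ → Ω → ℝ} {f' : Ω → ℝ}
    (hf : ∀ K, HasGaussianLaw (f K) P) (hf' : MemLp f' 2 P)
    (hff : Tendsto (fun K => eLpNorm (fun x => f K x - f' x) 2 P) atTop (𝓝 0)) :
    HasGaussianLaw f' P := by
  have hL : ∀ K, MemLp (f K) 2 P := fun K => (hf K).memLp_two
  have h1 := tendsto_eLpNorm_one hL hf' hff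
  have hmean : Tendsto (fun K => ∫ x, f K x ∂P) atTop (𝓝 (∫ x, f' x ∂P)) :=
    tendsto_integral_of_L1' _ hf'.1 (Eventually.of_forall fun K => (hf K).integrable) h1
  have hsq := tendsto_integral_mul hL hf' hL hf' hff hff
  have hvar : Tendsto (fun K => Var[f K; P]) atTop (𝓝 Var[f'; P]) := by
    have e : ∀ {g : Ω → ℝ}, MemLp g 2 P → Var[g; P] = ∫ x, g x * g x ∂P - (∫ x, g x ∂P) ^ 2 := by
      intro g hg
      rw [variance_eq_sub hg]; simp [pow_two]
    simp_rw [e hf', e (hL _)]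
    exact hsq.sub (hmean.pow 2)
  -- x ↦ e^{itx} is |t|-Lipschitz, so L¹ convergence carries characteristic functions to the limit.
  -- Convergence of means and variances carries the Gaussian formula to the same limit.
  have hchar : ∀ t : ℝ, Tendsto (fun K => charFun (P.map (f K)) t) atTop
      (𝓝 (charFun (P.map f') t)) := by
    intro t
    have e : ∀ {g : Ω → ℝ}, MemLp g 2 P →
        charFun (P.map g) t = ∫ x, Complex.exp ((t * g x : ℝ) * Complex.I) ∂P := by
      intro g hg
      rw [charFun_apply_real, integral_map hg.1.aemeasurable (by fun_prop)]
      simp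
    simp_rw [e hf', e (hL _)]
    have hm : ∀ {g : Ω → ℝ}, MemLp g 2 P →
        AEStronglyMeasurable (fun x => Complex.exp ((t * g x : ℝ) * Complex.I)) P := by
      intro g hg
      have := hg.1.aemeasurable
      exact AEMeasurable.aestronglyMeasurable (by fun_prop)
    refine tendsto_integral_of_L1' _ (hm hf') (Eventually.of_forall fun K => ?_) ?_
    · refine Integrable.of_bound (hm (hL K)) 1 (ae_of_all _ fun x => ?_)
      rw [Complex.norm_exp_ofReal_mul_I]
    · have h2 : Tendsto (fun K => ENNReal.ofReal |t| * eLpNorm (fun x => f K x - f' x) 1 P) atTop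
          (𝓝 0) := by
        simpa using ENNReal.Tendsto.const_mul h1 (Or.inr ENNReal.ofReal_ne_top)
      refine tendsto_of_tendsto_of_tendsto_of_le_of_le tendsto_const_nhds h2
        (fun _ => zero_le) fun K => ?_
      refine eLpNorm_le_mul_eLpNorm_of_ae_le_mul (ae_of_all _ fun x => ?_) 1
      have : ∀ a b : ℝ, ‖Complex.exp (a * Complex.I) - Complex.exp (b * Complex.I)‖ ≤ ‖a - b‖ := by
        intro a b
        have h3 := Real.norm_exp_I_mul_ofReal_sub_one_le (x := a - b)
        have h4 : Complex.exp (a * Complex.I) - Complex.exp (b * Complex.I) =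
            Complex.exp (b * Complex.I) * (Complex.exp (Complex.I * (a - b : ℝ)) - 1) := by
          rw [mul_sub, ← Complex.exp_add]; congr 2
          · push_cast; ring
          · ring
        rw [h4, norm_mul, Complex.norm_exp_ofReal_mul_I, one_mul]
        exact h3
      refine (this _ _).trans (le_of_eq ?_)
      rw [← mul_sub, norm_mul]; rfl
  have hlaw : P.map f' = gaussianReal (∫ x, f' x ∂P) Var[f'; P].toNNReal := by
    have := Measure.isProbabilityMeasure_map hf'.1.aemeasurable (μ := P)
    refine Measure.ext_of_charFun (funext fun t => ?_)
    refine tendsto_nhds_unique (hchar t) ?_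
    have e : ∀ K, charFun (P.map (f K)) t =
        Complex.exp (t * (∫ x, f K x ∂P : ℝ) * Complex.I - (Var[f K; P] : ℝ) * t ^ 2 / 2) := by
      intro K
      rw [(hf K).map_eq_gaussianReal, charFun_gaussianReal, Real.coe_toNNReal _ (variance_nonneg _ _)]
    simp_rw [e]
    rw [charFun_gaussianReal, Real.coe_toNNReal _ (variance_nonneg _ _)]
    refine (Complex.continuous_exp.tendsto _).comp ?_
    exact ((((Complex.continuous_ofReal.tendsto _).comp hmean).const_mul _).mul_const _).sub
      ((((Complex.continuous_ofReal.tendsto _).comp hvar).mul_const _).div_const _)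
  exact ⟨by rw [hlaw]; infer_instance⟩

omit [IsProbabilityMeasure P] in
/-- The Cramér-Wold device for two real random variables. -/
lemma hasGaussianLaw_prodMk_of_linear {A B : Ω → ℝ} (hA : AEMeasurable A P) (hB : AEMeasurable B P)
    (h : ∀ a b : ℝ, HasGaussianLaw (fun x => a * A x + b * B x) P) :
    HasGaussianLaw (fun x => (A x, B x)) P := by
  have hAB : AEMeasurable (fun x => (A x, B x)) P := hA.prodMk hB
  refine ⟨⟨fun ℓ => ?_⟩⟩
  have hℓ : (fun x => ℓ (A x, B x)) = fun x => ℓ (1, 0) * A x + ℓ (0, 1) * B x := by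
    funext x
    have : ((A x, B x) : ℝ × ℝ) = A x • ((1 : ℝ), (0 : ℝ)) + B x • ((0 : ℝ), (1 : ℝ)) := by simp
    rw [this, map_add, map_smul, map_smul]
    simp [mul_comm]
  have hg := (h (ℓ (1, 0)) (ℓ (0, 1)))
  rw [← hℓ] at hg
  rw [AEMeasurable.map_map_of_aemeasurable ℓ.continuous.aemeasurable hAB,
    integral_map hAB ℓ.continuous.aestronglyMeasurable,
    variance_map ℓ.continuous.aemeasurable hAB]
  exact hg.map_eq_gaussianReal

omit [IsProbabilityMeasure P] in
/-- Finite linear combinations of a Gaussian variable and an independent white Gaussian noise. -/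
lemma hasGaussianLaw_add_sum {X : Ω → ℝ} {N : ℤ → Ω → ℝ} (hX : HasGaussianLaw X P)
    (hN : ∀ n, HasGaussianLaw (N n) P) (hNi : iIndepFun N P)
    (hXN : IndepFun X (fun x n => N n x) P) (s : Finset ℤ) (a : ℝ) (b : ℤ → ℝ) :
    HasGaussianLaw (fun x => a * X x + ∑ k ∈ s, b k * N k x) P := by
  have h1 : HasGaussianLaw (fun x (k : s) => N k x) P :=
    iIndepFun.hasGaussianLaw (fun k => hN k) (hNi.precomp Subtype.val_injective)
  have h2 : IndepFun X (fun x (k : s) => N k x) P :=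
    hXN.comp (φ := id) (ψ := fun (y : ℤ → ℝ) (k : s) => y k) measurable_id (by fun_prop)
  have h3 := (h2.hasGaussianLaw hX h1).map_fun
    (a • ContinuousLinearMap.fst ℝ ℝ (s → ℝ) + ∑ k : s, b k •
      (ContinuousLinearMap.proj k).comp (ContinuousLinearMap.snd ℝ ℝ (s → ℝ)))
  refine h3.congr (ae_of_all _ fun x => ?_)
  simp [Finset.sum_attach s (fun k => b k * N k x)]

/-- Each a U_n + b N_n is a mean-square limit of finite Gaussian combinations, so the pair is
jointly Gaussian and independence reduces to zero covariance. N_n enters the feedback F_n only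
through c 0 = 0; all other noise samples are uncorrelated with N_n. -/
lemma hasGaussianLaw_input_and_indepFun {X : Ω → ℝ} {N F : ℤ → Ω → ℝ} {v : ℝ≥0} {c : ℤ → ℝ}
    (hX : HasGaussianLaw X P) (hX0 : ∫ x, X x ∂P = 0)
    (hN : ∀ n, HasLaw (N n) (gaussianReal 0 v) P) (hNi : iIndepFun N P)
    (hXN : IndepFun X (fun x n => N n x) P) (hc : c 0 = 0) (hF : IsFilterOutput P c N F) (n : ℤ) :
    HasGaussianLaw (fun x => X x - F n x) P ∧ ∫ x, (X x - F n x) ∂P = 0 ∧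
      IndepFun (fun x => X x - F n x) (N n) P := by
  have hNg : ∀ n, HasGaussianLaw (N n) P := fun n => (hN n).hasGaussianLaw
  obtain ⟨hFL, hFlim⟩ := hF n
  have hXL := hX.memLp_two
  have hNL : ∀ n, MemLp (N n) 2 P := fun n => (hNg n).memLp_two
  let S : ℕ → Ω → ℝ := fun K x => ∑ k ∈ Finset.Icc (-(K : ℤ)) K, c k * N (n - k) x
  have hS : ∀ K, MemLp (S K) 2 P := fun K =>
    memLp_finsetSum _ fun k _ => (hNL (n - k)).const_mul (c k)
  have hgauss : ∀ a b : ℝ, HasGaussianLaw (fun x => a * (X x - F n x) + b * N n x) P := by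
    intro a b
    refine hasGaussianLaw_of_tendsto (f := fun K x => a * (X x - S K x) + b * N n x)
      (fun K => ?_) (((hXL.sub hFL).const_mul a).add ((hNL n).const_mul b)) ?_
    -- The sum is reindexed by the noise time m = n - k. The time m = n lies in the index set, as k
    -- = 0 does in the window, and receives the extra coefficient b.
    · have := hasGaussianLaw_add_sum hX hNg hNi hXN
        ((Finset.Icc (-(K : ℤ)) K).image (fun k => n - k)) a
        (fun k => (if k = n then b else 0) - a * c (n - k))
      convert this using 2 with x
      rw [Finset.sum_image (by intro i _ j _ h; simpa using h)]
      simp only [sub_sub_cancel, sub_mul, Finset.sum_sub_distrib, S, mul_assoc, ← Finset.mul_sum]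
      have : ∑ k ∈ Finset.Icc (-(K : ℤ)) K, (if n - k = n then b else 0) * N (n - k) x
          = b * N n x := by
        rw [Finset.sum_eq_single 0]
        · simp
        · intro k _ hk; simp [hk]
        · intro h; simp at h
      rw [this]; ring
    · have h2 := ENNReal.Tendsto.const_mul (a := ENNReal.ofReal |a|) hFlim
        (Or.inr ENNReal.ofReal_ne_top)
      rw [mul_zero] at h2
      refine tendsto_of_tendsto_of_tendsto_of_le_of_le tendsto_const_nhds h2
        (fun _ => zero_le) fun K => ?_
      refine eLpNorm_le_mul_eLpNorm_of_ae_le_mul (ae_of_all _ fun x => le_of_eq ?_) 2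
      rw [← Real.norm_eq_abs a, ← norm_mul, ← norm_neg]
      congr 1
      simp only [S]; ring
  have hU : HasGaussianLaw (fun x => X x - F n x) P := by simpa using hgauss 1 0
  have hNmean : ∀ n, ∫ x, N n x ∂P = 0 := fun n => by
    rw [(hN n).integral_eq]; simp
  have hNcov : ∀ i j, i ≠ j → ∫ x, N i x * N j x ∂P = 0 := by
    intro i j hij
    rw [(hNi.indepFun hij).integral_fun_mul_eq_mul_integral (hNL i).1 (hNL j).1, hNmean, zero_mul]
  have hFmean : ∫ x, F n x ∂P = 0 := by
    have := tendsto_integral_of_L1' _ hFL.1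
      (Eventually.of_forall fun K => (hS K).integrable (by norm_num))
      (tendsto_eLpNorm_one hS hFL hFlim)
    refine tendsto_nhds_unique this ?_
    have e : ∀ K, ∫ x, S K x ∂P = 0 := by
      intro K
      simp only [S]
      rw [integral_finsetSum _ fun k _ => ((hNL (n - k)).integrable (by norm_num)).const_mul _]
      exact Finset.sum_eq_zero fun k _ => by rw [integral_const_mul, hNmean, mul_zero]
    simp [e]
  have hFN : ∫ x, F n x * N n x ∂P = 0 := by
    have := tendsto_integral_mul hS hFL (fun _ => hNL n) (hNL n) hFlim (by simp)
    refine tendsto_nhds_unique this ?_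
    have e : ∀ K, ∫ x, S K x * N n x ∂P = 0 := by
      intro K
      simp only [S, Finset.sum_mul, mul_assoc]
      rw [integral_finsetSum _ fun k _ => Integrable.const_mul (by exact (hNL (n - k)).integrable_mul (hNL n)) _]
      refine Finset.sum_eq_zero fun k _ => ?_
      rw [integral_const_mul]
      by_cases hk : k = 0
      · simp [hk, hc]
      · rw [hNcov _ _ (by omega), mul_zero]
    simp [e]
  have hXNn : ∫ x, X x * N n x ∂P = 0 := by
    have : IndepFun X (N n) P :=
      hXN.comp (φ := id) (ψ := fun (y : ℤ → ℝ) => y n) measurable_id (by fun_prop)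
    rw [this.integral_fun_mul_eq_mul_integral hXL.1 (hNL n).1, hNmean, mul_zero]
  have hUmean : ∫ x, (X x - F n x) ∂P = 0 := by
    rw [integral_sub hX.integrable (hFL.integrable (by norm_num)), hX0, hFmean, sub_zero]
  refine ⟨hU, hUmean, ?_⟩
  refine (hasGaussianLaw_prodMk_of_linear hU.aemeasurable (hNg n).aemeasurable
    hgauss).indepFun_of_covariance_eq_zero ?_
  rw [covariance_eq_sub hU.memLp_two (hNL n), hNmean, mul_zero, sub_zero]
  simp only [Pi.mul_apply, sub_mul]
  rw [integral_sub (by exact hXL.integrable_mul (hNL n)) (by exact hFL.integrable_mul (hNL n)), hXNn, hFN, sub_zero]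

end Probability

/-! ### Spectral measures and finite filters -/

lemma trigSum_mul_conj (s : Finset ℤ) (z : ℤ → ℂ) (w : ℝ) :
    trigSum s z w * (starRingEnd ℂ) (trigSum s z w) = ∑ k ∈ s, ∑ l ∈ s,
      z k * (starRingEnd ℂ) (z l) * Complex.exp (Complex.I * w * ((l - k : ℤ) : ℂ)) := by
  simp only [trigSum, map_sum, map_mul, Finset.sum_mul_sum, ← Complex.exp_conj]
  refine Finset.sum_congr rfl fun k _ => Finset.sum_congr rfl fun l _ => ?_
  rw [show ∀ a b c d : ℂ, a * b * (c * d) = a * c * (b * d) by intros; ring, ← Complex.exp_add]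
  congr 2
  simp
  ring

lemma norm_exp_I_mul_int (w : ℝ) (k : ℤ) : ‖Complex.exp (Complex.I * w * (k : ℂ))‖ = 1 := by
  rw [Complex.norm_exp]; simp

lemma norm_trigSum_le (s : Finset ℤ) (z : ℤ → ℂ) (w : ℝ) : ‖trigSum s z w‖ ≤ ∑ k ∈ s, ‖z k‖ := by
  refine (norm_sum_le _ _).trans (Finset.sum_le_sum fun k _ => ?_)
  rw [norm_mul, Complex.norm_exp]; simp

lemma memLp_trigSum (s : Finset ℤ) (z : ℤ → ℂ) (μ : Measure ℝ) [IsFiniteMeasure μ] (p : ℝ≥0∞) :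
    MemLp (trigSum s z) p μ :=
  MemLp.of_bound (continuous_trigSum s z).aestronglyMeasurable _
    (ae_of_all _ (norm_trigSum_le s z))

lemma integrable_mul_exp {μ : Measure ℝ} {g : ℝ → ℂ} (hg : Integrable g μ) (k : ℤ) :
    Integrable (fun w => g w * Complex.exp (Complex.I * w * (k : ℂ))) μ :=
  hg.mul_bdd (c := 1) (Continuous.aestronglyMeasurable (by fun_prop))
    (ae_of_all _ fun w => (norm_exp_I_mul_int w k).le)

section Filtering

variable {Ω : Type*} [MeasurableSpace Ω] {P : Measure Ω}

/-- Cross-correlation of two shifted outputs of a finite filter, in the frequency domain. -/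
lemma integral_filter_mul_conj {Z : ℤ → Ω → ℝ} (hZ : ∀ n, MemLp (Z n) 2 P) {μ : Measure ℝ}
    {g : ℝ → ℂ} (hg : Integrable g μ)
    (hcov : ∀ i j : ℤ, ((∫ x, Z i x * Z j x ∂P : ℝ) : ℂ) =
      ∫ w : ℝ, g w * Complex.exp (Complex.I * w * ((i - j : ℤ) : ℂ)) ∂μ)
    (s : Finset ℤ) (z : ℤ → ℂ) (m n : ℤ) :
    ∫ x, (∑ k ∈ s, z k * (Z (m - k) x : ℂ)) *
      (starRingEnd ℂ) (∑ k ∈ s, z k * (Z (n - k) x : ℂ)) ∂P =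
    ∫ w : ℝ, g w * (trigSum s z w * (starRingEnd ℂ) (trigSum s z w)) *
      Complex.exp (Complex.I * w * ((m - n : ℤ) : ℂ)) ∂μ := by
  have hint : ∀ i j, Integrable (fun x => ((Z i x * Z j x : ℝ) : ℂ)) P := fun i j =>
    ((hZ i).integrable_mul (hZ j)).ofReal
  have hL : ∫ x, (∑ k ∈ s, z k * (Z (m - k) x : ℂ)) *
      (starRingEnd ℂ) (∑ k ∈ s, z k * (Z (n - k) x : ℂ)) ∂P =
      ∑ k ∈ s, ∑ l ∈ s, z k * (starRingEnd ℂ) (z l) *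
        ((∫ x, Z (m - k) x * Z (n - l) x ∂P : ℝ) : ℂ) := by
    have e : ∀ x, (∑ k ∈ s, z k * (Z (m - k) x : ℂ)) *
      (starRingEnd ℂ) (∑ k ∈ s, z k * (Z (n - k) x : ℂ)) = ∑ k ∈ s, ∑ l ∈ s,
        z k * (starRingEnd ℂ) (z l) * ((Z (m - k) x * Z (n - l) x : ℝ) : ℂ) := by
      intro x
      simp only [map_sum, map_mul, Complex.conj_ofReal, Finset.sum_mul_sum]
      refine Finset.sum_congr rfl fun k _ => Finset.sum_congr rfl fun l _ => ?_
      push_cast; ring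
    simp_rw [e]
    rw [integral_finsetSum _ fun k _ => integrable_finsetSum _ fun l _ =>
      (hint (m - k) (n - l)).const_mul _]
    refine Finset.sum_congr rfl fun k _ => ?_
    rw [integral_finsetSum _ fun l _ => (hint (m - k) (n - l)).const_mul _]
    refine Finset.sum_congr rfl fun l _ => ?_
    rw [integral_const_mul, integral_complex_ofReal]
  have hR : ∫ w : ℝ, g w * (trigSum s z w * (starRingEnd ℂ) (trigSum s z w)) *
      Complex.exp (Complex.I * w * ((m - n : ℤ) : ℂ)) ∂μ =
      ∑ k ∈ s, ∑ l ∈ s, z k * (starRingEnd ℂ) (z l) *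
        ∫ w : ℝ, g w * Complex.exp (Complex.I * w * (((m - k) - (n - l) : ℤ) : ℂ)) ∂μ := by
    have e : ∀ w : ℝ, g w * (trigSum s z w * (starRingEnd ℂ) (trigSum s z w)) *
      Complex.exp (Complex.I * w * ((m - n : ℤ) : ℂ)) = ∑ k ∈ s, ∑ l ∈ s,
        z k * (starRingEnd ℂ) (z l) *
          (g w * Complex.exp (Complex.I * w * (((m - k) - (n - l) : ℤ) : ℂ))) := by
      intro w
      rw [trigSum_mul_conj, Finset.mul_sum, Finset.sum_mul]
      refine Finset.sum_congr rfl fun k _ => ?_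
      rw [Finset.mul_sum, Finset.sum_mul]
      refine Finset.sum_congr rfl fun l _ => ?_
      rw [show (((m - k) - (n - l) : ℤ) : ℂ) = ((l - k : ℤ) : ℂ) + ((m - n : ℤ) : ℂ) by
        push_cast; ring, mul_add, Complex.exp_add]
      ring
    simp_rw [e]
    rw [integral_finsetSum _ fun k _ => integrable_finsetSum _ fun l _ =>
      (integrable_mul_exp hg _).const_mul _]
    refine Finset.sum_congr rfl fun k _ => ?_
    rw [integral_finsetSum _ fun l _ => (integrable_mul_exp hg _).const_mul _]
    exact Finset.sum_congr rfl fun l _ => integral_const_mul _ _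
  rw [hL, hR]
  exact Finset.sum_congr rfl fun k _ => Finset.sum_congr rfl fun l _ => by rw [hcov]

/-- `μ` is the spectral measure of the square-integrable process `Z`. -/
structure HasSpectralMeasure (P : Measure Ω) (Z : ℤ → Ω → ℝ) (μ : Measure ℝ) : Prop where
  memLp : ∀ n, MemLp (Z n) 2 P
  covariance : ∀ i j : ℤ, ((∫ x, Z i x * Z j x ∂P : ℝ) : ℂ) =
    ∫ w : ℝ, Complex.exp (Complex.I * w * ((i - j : ℤ) : ℂ)) ∂μ

lemma eLpNorm_two_eq {α E : Type*} [MeasurableSpace α] [NormedAddCommGroup E] {μ : Measure α}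
    {f : α → E} (hf : MemLp f 2 μ) : eLpNorm f 2 μ = ENNReal.ofReal √(∫ x, ‖f x‖ ^ 2 ∂μ) := by
  rw [hf.eLpNorm_eq_integral_rpow_norm (by norm_num) (by norm_num), Real.sqrt_eq_rpow]
  norm_num

namespace HasSpectralMeasure

variable {Z : ℤ → Ω → ℝ} {μ : Measure ℝ} [IsFiniteMeasure μ]

omit [IsFiniteMeasure μ] in
lemma memLp_sum (hZ : HasSpectralMeasure P Z μ) (s : Finset ℤ) (a : ℤ → ℝ) (n : ℤ) :
    MemLp (fun x => ∑ k ∈ s, a k * Z (n - k) x) 2 P :=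
  memLp_finsetSum _ fun k _ => (hZ.memLp (n - k)).const_mul (a k)

lemma integral_filter_mul (hZ : HasSpectralMeasure P Z μ) (s : Finset ℤ) (a : ℤ → ℝ) (m n : ℤ) :
    ((∫ x, (∑ k ∈ s, a k * Z (m - k) x) * (∑ k ∈ s, a k * Z (n - k) x) ∂P : ℝ) : ℂ) =
    ∫ w : ℝ, (trigSum s (fun k => (a k : ℂ)) w *
      (starRingEnd ℂ) (trigSum s (fun k => (a k : ℂ)) w)) *
      Complex.exp (Complex.I * w * ((m - n : ℤ) : ℂ)) ∂μ := by
  have := integral_filter_mul_conj hZ.memLp (g := fun _ => 1) (μ := μ) (integrable_const _)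
    (by simpa only [one_mul] using hZ.covariance) s (fun k => (a k : ℂ)) m n
  simp only [one_mul] at this
  rw [← this, ← integral_complex_ofReal]
  refine integral_congr_ae (ae_of_all _ fun x => ?_)
  simp

/-- Finite filters act isometrically. -/
lemma eLpNorm_sum (hZ : HasSpectralMeasure P Z μ) (s : Finset ℤ) (a : ℤ → ℝ) (n : ℤ) :
    eLpNorm (fun x => ∑ k ∈ s, a k * Z (n - k) x) 2 P =
      eLpNorm (trigSum s (fun k => (a k : ℂ))) 2 μ := by
  rw [eLpNorm_two_eq (hZ.memLp_sum s a n), eLpNorm_two_eq (memLp_trigSum s _ μ 2)]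
  congr 2
  have := hZ.integral_filter_mul s a n n
  simp only [sub_self, Int.cast_zero, mul_zero, Complex.exp_zero, mul_one, Complex.mul_conj'] at this
  have h2 : ∫ w, (‖trigSum s (fun k => (a k : ℂ)) w‖ ^ 2 : ℂ) ∂μ =
      ((∫ w, ‖trigSum s (fun k => (a k : ℂ)) w‖ ^ 2 ∂μ : ℝ) : ℂ) := by
    rw [← integral_complex_ofReal]; simp
  rw [h2, Complex.ofReal_inj] at this
  rw [← this]
  simp [pow_two]

/-- Spectral measure of the output of a filter with transfer function `A`. -/
lemma filterOutput (hZ : HasSpectralMeasure P Z μ) {a : ℤ → ℝ} {A : ℝ → ℂ} (hA : MemLp A 2 μ)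
    (hlim : Tendsto (fun K : ℕ => eLpNorm (fun w =>
      trigSum (Finset.Icc (-(K : ℤ)) K) (fun k => (a k : ℂ)) w - A w) 2 μ) atTop (𝓝 0))
    {W : ℤ → Ω → ℝ} (hW : IsFilterOutput P a Z W) :
    HasSpectralMeasure P W (μ.withDensity fun w => ENNReal.ofReal (‖A w‖ ^ 2)) := by
  refine ⟨fun n => (hW n).1, fun i j => ?_⟩
  let T : ℕ → ℝ → ℂ := fun K => trigSum (Finset.Icc (-(K : ℤ)) K) (fun k => (a k : ℂ))
  have hT : ∀ K, MemLp (T K) 2 μ := fun K => memLp_trigSum _ _ μ 2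
  have h1 := tendsto_integral_mul (fun K => hZ.memLp_sum (Finset.Icc (-(K : ℤ)) K) a i) (hW i).1
    (fun K => hZ.memLp_sum (Finset.Icc (-(K : ℤ)) K) a j) (hW j).1 (hW i).2 (hW j).2
  have h1' := (Complex.continuous_ofReal.tendsto _).comp h1
  -- The factor e^{jω(i-j)} has modulus 1, so it can be absorbed into one argument of the L² inner
  -- product without affecting convergence.
  have hmul : ∀ {f : ℝ → ℂ}, MemLp f 2 μ →
      MemLp (fun w : ℝ => f w * Complex.exp (Complex.I * w * ((i - j : ℤ) : ℂ))) 2 μ := by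
    intro f hf
    refine hf.of_le (hf.1.mul (Continuous.aestronglyMeasurable (by fun_prop)))
      (ae_of_all _ fun w => ?_)
    rw [norm_mul, norm_exp_I_mul_int, mul_one]
  have h2 := tendsto_integral_mul_conj (𝕜 := ℂ) (fun K => hmul (hT K)) (hmul hA) hT hA (by
    refine hlim.congr fun K => eLpNorm_congr_norm_ae (ae_of_all _ fun w => ?_)
    rw [← sub_mul, norm_mul, norm_exp_I_mul_int, mul_one]) hlim
  have h3 := tendsto_nhds_unique (h1'.congr fun K => ?_) h2
  · rw [h3, integral_withDensity_eq_integral_toReal_smul₀]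
    · refine integral_congr_ae (ae_of_all _ fun w => ?_)
      simp only
      rw [ENNReal.toReal_ofReal (by positivity), Complex.real_smul, mul_right_comm,
        Complex.mul_conj']
      simp
    · exact (hA.1.norm.aemeasurable.pow_const 2).ennreal_ofReal
    · exact ae_of_all _ fun w => ENNReal.ofReal_lt_top
  · simp only [Function.comp]
    rw [hZ.integral_filter_mul]
    refine integral_congr_ae (ae_of_all _ fun w => ?_)
    simp only [T]; ring

end HasSpectralMeasure

lemma integral_exp_int (k : ℤ) :
    ∫ w in Set.Ioc (-Real.pi) Real.pi, Complex.exp (Complex.I * w * (k : ℂ)) =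
      if k = 0 then 2 * Real.pi else 0 := by
  have hpi := Real.pi_pos
  rw [← intervalIntegral.integral_of_le (by linarith)]
  split_ifs with hk
  · subst hk; simp; ring
  · have h : ∀ w : ℝ, Complex.exp (Complex.I * w * (k : ℂ)) = Complex.exp ((Complex.I * k) * w) := by
      intro w; congr 1; ring
    simp_rw [h]
    rw [integral_exp_mul_complex (by simp [hk])]
    have : Complex.exp (Complex.I * k * (Real.pi : ℝ)) =
        Complex.exp (Complex.I * k * ((-Real.pi : ℝ) : ℂ)) := by
      rw [Complex.exp_eq_exp_iff_exists_int]
      exact ⟨k, by push_cast; ring⟩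
    rw [this, sub_self, zero_div, Complex.ofReal_zero]

/-- The normalised Lebesgue measure on `(-π, π]`. -/
noncomputable def circleMeasure : Measure ℝ :=
  ENNReal.ofReal (1 / (2 * Real.pi)) • volume.restrict (Set.Ioc (-Real.pi) Real.pi)

lemma hasSpectralMeasure_whiteNoise [IsProbabilityMeasure P] {N : ℤ → Ω → ℝ} {v : ℝ≥0}
    (hN : ∀ n, HasLaw (N n) (gaussianReal 0 v) P) (hNi : iIndepFun N P) :
    HasSpectralMeasure P N ((v : ℝ≥0∞) • circleMeasure) := by
  have hNL : ∀ n, MemLp (N n) 2 P := fun n => (hN n).hasGaussianLaw.memLp_two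
  have hNmean : ∀ n, ∫ x, N n x ∂P = 0 := fun n => by rw [(hN n).integral_eq]; simp
  refine ⟨hNL, fun i j => ?_⟩
  rw [circleMeasure, integral_smul_measure, integral_smul_measure, integral_exp_int]
  have hpi := Real.pi_pos
  rw [ENNReal.toReal_ofReal (by positivity)]
  by_cases hij : i = j
  · subst hij
    have : ∫ x, N i x * N i x ∂P = v := by
      have h1 := (hN i).variance_eq
      rw [variance_eq_sub (hNL i), hNmean] at h1
      simpa [pow_two] using h1
    rw [this]
    simp
    field_simp
  · rw [(hNi.indepFun hij).integral_fun_mul_eq_mul_integral (hNL i).1 (hNL j).1, hNmean, zero_mul,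
      if_neg (by omega)]
    simp

end Filtering

/-! ### Density of trigonometric polynomials and positivity of the spectral density -/

/-- Trigonometric polynomials are dense in `L²(μ)` for finite measures `μ` on `(-π, π]`. -/
lemma exists_trigSum_eLpNorm_sub_le {μ : Measure ℝ} [IsFiniteMeasure μ]
    (hμ : ∀ᵐ w ∂μ, w ∈ Set.Ioc (-Real.pi) Real.pi) {f : ℝ → ℂ} (hfm : Measurable f) {M : ℝ}
    (hfM : ∀ w, ‖f w‖ ≤ M) {ε : ℝ≥0∞} (hε : ε ≠ 0) :
    ∃ (s : Finset ℤ) (z : ℤ → ℂ), eLpNorm (fun w => f w - trigSum s z w) 2 μ ≤ ε := by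
  have hpi := Real.pi_pos
  have : Fact (0 < 2 * Real.pi) := ⟨by positivity⟩
  -- The half-open interval is in bijection with the circle, so f descends to the circle, where
  -- Stone-Weierstrass gives uniform density of trigonometric polynomials.
  let π : ℝ → AddCircle (2 * Real.pi) := fun w => (w : AddCircle (2 * Real.pi))
  have hπ : Measurable π := AddCircle.measurable_mk'
  let F : AddCircle (2 * Real.pi) → ℂ := fun x =>
    f (AddCircle.measurableEquivIoc (2 * Real.pi) (-Real.pi) x : ℝ)
  have hFm : Measurable F := hfm.comp (measurable_subtype_coe.comp (MeasurableEquiv.measurable _))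
  have hFπ : ∀ w ∈ Set.Ioc (-Real.pi) Real.pi, F (π w) = f w := by
    intro w hw
    have hw' : w ∈ Set.Ioc (-Real.pi) (-Real.pi + 2 * Real.pi) := by
      rwa [show -Real.pi + 2 * Real.pi = Real.pi by ring]
    have h1 : (AddCircle.measurableEquivIoc (2 * Real.pi) (-Real.pi) (π w) : ℝ) = w :=
      AddCircle.equivIoc_coe_of_mem hw'
    simp only [F, h1]
  set μ' := μ.map π with hμ'
  have : IsFiniteMeasure μ' := Measure.isFiniteMeasure_map μ π
  have hFL : MemLp F 2 μ' := MemLp.of_bound hFm.aestronglyMeasurable M (ae_of_all _ fun x => hfM _)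
  have hε2 : ε / 2 ≠ 0 := (ENNReal.half_pos hε).ne'
  obtain ⟨g, hg, hgL⟩ := hFL.exists_boundedContinuous_eLpNorm_sub_le (by norm_num) hε2
  let g' : C(AddCircle (2 * Real.pi), ℂ) := g.toContinuousMap
  -- A uniform error δ costs at most ε/2 in L²; the other ε/2 pays for the continuous approximation.
  obtain ⟨δ, hδ0, hδ⟩ : ∃ δ : ℝ, 0 < δ ∧
      ENNReal.ofReal δ * μ' Set.univ ^ (1 / 2 : ℝ) ≤ ε / 2 := by
    have hlim : Tendsto (fun δ : ℝ => ENNReal.ofReal δ * μ' Set.univ ^ (1 / 2 : ℝ))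
        (𝓝[>] 0) (𝓝 0) := by
      have h1 : Tendsto (fun δ : ℝ => ENNReal.ofReal δ) (𝓝[>] 0) (𝓝 0) := by
        have := (ENNReal.continuous_ofReal.tendsto (0 : ℝ)).mono_left
          (nhdsWithin_le_nhds (s := Set.Ioi 0))
        simpa using this
      simpa using ENNReal.Tendsto.mul_const (b := μ' Set.univ ^ (1 / 2 : ℝ)) h1
        (Or.inr (ENNReal.rpow_ne_top_of_nonneg (by norm_num) (measure_ne_top _ _)))
    have h2 := (hlim.eventually (gt_mem_nhds (pos_iff_ne_zero.2 hε2))).and self_mem_nhdsWithin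
    obtain ⟨δ, hδ1, hδ2⟩ := h2.exists
    exact ⟨δ, hδ2, hδ1.le⟩
  have hmem : g' ∈ (Submodule.span ℂ (Set.range (@fourier (2 * Real.pi)))).topologicalClosure := by
    rw [span_fourier_closure_eq_top]; trivial
  obtain ⟨p, hp, hpd⟩ := Metric.mem_closure_iff.1 hmem δ hδ0
  obtain ⟨c, rfl⟩ := Finsupp.mem_span_range_iff_exists_finsupp.1 hp
  have hpw : ∀ w : ℝ, (c.sum fun i a => a • @fourier (2 * Real.pi) i) (π w) =
      trigSum (c.support.map (Equiv.neg ℤ).toEmbedding) (fun k => c (-k)) w := by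
    intro w
    rw [trigSum, Finset.sum_map, Finsupp.sum, ContinuousMap.sum_apply]
    refine Finset.sum_congr rfl fun k _ => ?_
    rw [ContinuousMap.smul_apply, fourier_coe_apply]
    simp only [Equiv.coe_toEmbedding, Equiv.neg_apply, neg_neg, smul_eq_mul]
    congr 2
    push_cast
    field_simp
  refine ⟨c.support.map (Equiv.neg ℤ).toEmbedding, fun k => c (-k), ?_⟩
  set p := c.sum fun i a => a • @fourier (2 * Real.pi) i with hpdef
  have h1 : eLpNorm (fun w => f w - trigSum (c.support.map (Equiv.neg ℤ).toEmbedding)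
      (fun k => c (-k)) w) 2 μ = eLpNorm (fun x => F x - p x) 2 μ' := by
    rw [hμ', eLpNorm_map_measure (g := fun x => F x - p x) (hFm.aestronglyMeasurable.sub
      p.continuous.aestronglyMeasurable) hπ.aemeasurable]
    refine eLpNorm_congr_ae ?_
    filter_upwards [hμ] with w hw
    simp only [Function.comp]
    rw [hFπ w hw, hpw]
  rw [h1]
  have h2 : (fun x => F x - p x) = (F - g) + (fun x => g' x - p x) := by
    funext x; simp [g']
  rw [h2]
  refine (eLpNorm_add_le (hFL.1.sub hgL.1)
    (g'.continuous.sub p.continuous).aestronglyMeasurable (by norm_num)).trans ?_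
  rw [← ENNReal.add_halves ε]
  refine add_le_add hg (le_trans ?_ hδ)
  have h3 := eLpNorm_le_of_ae_bound (p := 2) (μ := μ') (f := fun x => g' x - p x) (C := δ)
    (ae_of_all _ fun x => by
      have := ContinuousMap.dist_apply_le_dist (f := g') (g := p) x
      rw [← dist_eq_norm]
      exact this.trans hpd.le)
  refine h3.trans (le_of_eq ?_)
  rw [mul_comm (ENNReal.ofReal δ)]
  norm_num

/-- With μp and μm of densities S⁺ and S⁻, the hypothesis says that the L²(μm) norm of a
trigonometric polynomial is at most its L²(μp) norm. Approximating the indicator of {S < 0} in L²(μp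
+ μm) controls both norms at once; its μp norm is 0, hence so is its μm norm. -/
lemma ae_nonneg_of_forall_trigSum {S : ℝ → ℝ} (hS : IntegrableOn S (Set.Ioc (-Real.pi) Real.pi))
    (hpos : ∀ (s : Finset ℤ) (z : ℤ → ℂ),
      0 ≤ ∫ w in Set.Ioc (-Real.pi) Real.pi, S w * ‖trigSum s z w‖ ^ 2) :
    ∀ᵐ w ∂(volume.restrict (Set.Ioc (-Real.pi) Real.pi)), 0 ≤ S w := by
  set lam := volume.restrict (Set.Ioc (-Real.pi) Real.pi) with hlam
  set S' := hS.1.mk S with hS'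
  have hSS' : S =ᵐ[lam] S' := hS.1.ae_eq_mk
  have hS'm : Measurable S' := hS.1.stronglyMeasurable_mk.measurable
  have hS'i : Integrable S' lam := hS.congr hSS'
  let μp := lam.withDensity fun w => ENNReal.ofReal (S' w)
  let μm := lam.withDensity fun w => ENNReal.ofReal (-S' w)
  have : IsFiniteMeasure μp := isFiniteMeasure_withDensity_ofReal hS'i.2
  have : IsFiniteMeasure μm := isFiniteMeasure_withDensity_ofReal hS'i.neg.2
  have hac : ∀ᵐ w ∂lam, w ∈ Set.Ioc (-Real.pi) Real.pi := ae_restrict_mem measurableSet_Ioc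
  have hmem : ∀ᵐ w ∂(μp + μm), w ∈ Set.Ioc (-Real.pi) Real.pi := by
    rw [ae_add_measure_iff]
    exact ⟨(withDensity_absolutelyContinuous _ _).ae_le hac,
      (withDensity_absolutelyContinuous _ _).ae_le hac⟩
  have hle : ∀ (s : Finset ℤ) (z : ℤ → ℂ),
      eLpNorm (trigSum s z) 2 μm ≤ eLpNorm (trigSum s z) 2 μp := by
    intro s z
    have hc : Measurable (trigSum s z) := (continuous_trigSum s z).measurable
    have h1 : 0 ≤ ∫ w, S' w * ‖trigSum s z w‖ ^ 2 ∂lam := by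
      refine (hpos s z).trans (le_of_eq (integral_congr_ae ?_))
      filter_upwards [hSS'] with w hw
      rw [hw]
    have hi : Integrable (fun w => S' w * ‖trigSum s z w‖ ^ 2) lam := by
      refine hS'i.mul_bdd (c := (∑ k ∈ s, ‖z k‖) ^ 2) (hc.norm.pow_const 2).aestronglyMeasurable
        (ae_of_all _ fun w => ?_)
      rw [norm_pow, norm_norm]
      gcongr
      exact norm_trigSum_le s z w
    rw [integral_eq_lintegral_pos_part_sub_lintegral_neg_part hi, sub_nonneg,
      ENNReal.toReal_le_toReal (by exact hi.neg.lintegral_lt_top.ne)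
        hi.lintegral_lt_top.ne] at h1
    rw [eLpNorm_eq_lintegral_rpow_enorm_toReal (by norm_num) (by norm_num),
      eLpNorm_eq_lintegral_rpow_enorm_toReal (by norm_num) (by norm_num)]
    refine ENNReal.rpow_le_rpow ?_ (by norm_num)
    rw [lintegral_withDensity_eq_lintegral_mul _ (by fun_prop) (by fun_prop),
      lintegral_withDensity_eq_lintegral_mul _ (by fun_prop) (by fun_prop)]
    have e : ∀ a : ℝ, ∀ w, ENNReal.ofReal (a * ‖trigSum s z w‖ ^ 2) =
        ENNReal.ofReal a * ‖trigSum s z w‖ₑ ^ (2 : ℝ≥0∞).toReal := by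
      intro a w
      rw [ENNReal.ofReal_mul' (by positivity), ENNReal.ofReal_pow (norm_nonneg _),
        ofReal_norm]
      norm_num
    simpa only [Pi.mul_apply, ← e, neg_mul] using h1
  classical
  let A : Set ℝ := {w | S' w < 0}
  have hA : MeasurableSet A := measurableSet_lt hS'm measurable_const
  let f : ℝ → ℂ := A.indicator fun _ => 1
  have hfm : Measurable f := measurable_const.indicator hA
  have hfp : eLpNorm f 2 μp = 0 := by
    rw [eLpNorm_eq_zero_iff hfm.aestronglyMeasurable (by norm_num)]
    have hz : μp A = 0 := by
      rw [withDensity_apply _ hA]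
      refine setLIntegral_eq_zero hA fun w hw => ?_
      simpa using (show S' w < 0 from hw).le
    filter_upwards [measure_eq_zero_iff_ae_notMem.1 hz] with w hw
    simp [f, hw]
  have hfmz : eLpNorm f 2 μm = 0 := by
    refine le_antisymm (ENNReal.le_of_forall_pos_le_add fun ε hε _ => ?_) zero_le
    obtain ⟨s, z, hsz⟩ := exists_trigSum_eLpNorm_sub_le hmem hfm (M := 1) (fun w => by
      by_cases hw : w ∈ A <;> simp [f, hw]) (ENNReal.half_pos (ENNReal.coe_ne_zero.2 hε.ne')).ne'
    have hc := (continuous_trigSum s z).measurable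
    have hsub := (hfm.sub hc)
    have hm := (eLpNorm_mono_measure (p := 2) (fun w => f w - trigSum s z w)
      (Measure.le_add_left le_rfl : μm ≤ μp + μm)).trans hsz
    have hp := (eLpNorm_mono_measure (p := 2) (fun w => f w - trigSum s z w)
      (Measure.le_add_right le_rfl : μp ≤ μp + μm)).trans hsz
    have h1 : eLpNorm f 2 μm ≤ eLpNorm (fun w => f w - trigSum s z w) 2 μm +
        eLpNorm (trigSum s z) 2 μm := by
      refine le_trans (le_of_eq ?_) (eLpNorm_add_le hsub.aestronglyMeasurable
        hc.aestronglyMeasurable (by norm_num))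
      congr 1; funext w; simp
    have h2 : eLpNorm (trigSum s z) 2 μp ≤ eLpNorm f 2 μp +
        eLpNorm (fun w => f w - trigSum s z w) 2 μp := by
      refine le_trans (le_of_eq ?_) (eLpNorm_sub_le hfm.aestronglyMeasurable
        hsub.aestronglyMeasurable (by norm_num))
      congr 1; funext w; simp
    rw [hfp, zero_add] at h2
    rw [zero_add, ← ENNReal.add_halves (ε : ℝ≥0∞)]
    exact h1.trans (add_le_add hm ((hle s z).trans (h2.trans hp)))
  have hz : μm A = 0 := by
    rw [eLpNorm_eq_zero_iff hfm.aestronglyMeasurable (by norm_num)] at hfmz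
    rw [measure_eq_zero_iff_ae_notMem]
    filter_upwards [hfmz] with w hw hwA
    simp [f, hwA] at hw
  rw [withDensity_apply _ hA, lintegral_eq_zero_iff (by fun_prop)] at hz
  rw [Filter.EventuallyEq, ae_restrict_iff' hA] at hz
  filter_upwards [hz, hSS'] with w hw hw'
  rw [hw']
  by_contra hneg
  have := hw (not_le.1 hneg)
  simp at this
  exact hneg this


/-! ### Fourier series and the ideal low-pass filter -/

lemma tendsto_Icc_neg_atTop : Tendsto (fun K : ℕ => Finset.Icc (-(K : ℤ)) K) atTop atTop := by
  refine tendsto_atTop_finset_of_monotone (fun a b hab => ?_) fun k => ⟨k.natAbs, ?_⟩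
  · exact Finset.Icc_subset_Icc (by omega) (by omega)
  · rw [Finset.mem_Icc]; omega

/-- Riesz-Fischer: a square-integrable function is the Fourier transform of its coefficients. -/
lemma isFourierTransform_of_coeff {f : ℝ → ℂ}
    (hf : MemLp f 2 (volume.restrict (Set.Ioc (-Real.pi) Real.pi))) {a : ℤ → ℝ}
    (ha : ∀ k, (a k : ℂ) = 1 / (2 * Real.pi) *
      ∫ w in Set.Ioc (-Real.pi) Real.pi, f w * Complex.exp (Complex.I * w * (k : ℂ))) :
    IsFourierTransform a f := by
  refine ⟨hf, ?_⟩
  have hpi := Real.pi_pos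
  have : Fact (0 < 2 * Real.pi) := ⟨by positivity⟩
  have hend : -Real.pi + 2 * Real.pi = Real.pi := by ring
  have hf' : MemLp f 2 (volume.restrict (Set.Ioc (-Real.pi) (-Real.pi + 2 * Real.pi))) := by
    rwa [hend]
  set F := AddCircle.liftIoc (2 * Real.pi) (-Real.pi) f with hFdef
  have hFv : MemLp F 2 := hf'.memLp_liftIoc
  have hF : MemLp F 2 AddCircle.haarAddCircle := hFv.haarAddCircle
  have hlift : ∀ w ∈ Set.Ioc (-Real.pi) Real.pi, F (w : AddCircle (2 * Real.pi)) = f w := by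
    intro w hw
    exact AddCircle.liftIoc_coe_apply (by rwa [hend])
  have hexp : ∀ (k : ℤ) (w : ℝ), @fourier (2 * Real.pi) k (w : AddCircle (2 * Real.pi)) =
      Complex.exp (Complex.I * w * (k : ℂ)) := by
    intro k w
    rw [fourier_coe_apply]; congr 1; push_cast; field_simp
  -- The index changes sign because `fourier n` is e^{+jnω}, whereas transfer functions are written
  -- in powers of e^{-jω}.
  have hcoef : ∀ n, fourierCoeff (hF.toLp F) n = a (-n) := by
    intro n
    rw [fourierCoeff_congr_ae hF.coeFn_toLp, fourierCoeff_eq_intervalIntegral _ _ (-Real.pi), hend,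
      intervalIntegral.integral_of_le (by linarith), ha, Complex.real_smul]
    push_cast
    congr 1
    refine setIntegral_congr_fun measurableSet_Ioc fun w hw => ?_
    simp only [smul_eq_mul]
    rw [hlift w hw, hexp, mul_comm]
    push_cast; rfl
  have hsum := (hasSum_fourier_series_L2 (hF.toLp F)).comp tendsto_Icc_neg_atTop
  let p : ℕ → C(AddCircle (2 * Real.pi), ℂ) := fun K =>
    ∑ i ∈ Finset.Icc (-(K : ℤ)) K, (a (-i) : ℂ) • fourier i
  have hpL : ∀ K, MemLp (p K) 2 (AddCircle.haarAddCircle (T := 2 * Real.pi)) := fun K =>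
    MemLp.of_bound (p K).continuous.aestronglyMeasurable ‖p K‖
      (ae_of_all _ fun x => (p K).norm_coe_le_norm x)
  have hps : ∀ K, ((fun s : Finset ℤ => ∑ i ∈ s, fourierCoeff (hF.toLp F) i • fourierLp 2 i) ∘
      fun K : ℕ => Finset.Icc (-(K : ℤ)) K) K = (hpL K).toLp (p K) := by
    intro K
    refine Lp.ext ?_
    refine EventuallyEq.trans ?_ (hpL K).coeFn_toLp.symm
    have e : ((fun s : Finset ℤ => ∑ i ∈ s, fourierCoeff (hF.toLp F) i • fourierLp 2 i) ∘
      fun K : ℕ => Finset.Icc (-(K : ℤ)) K) K =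
        ContinuousMap.toLp (E := ℂ) 2 AddCircle.haarAddCircle ℂ (p K) := by
      simp only [Function.comp, p, map_sum, map_smul, hcoef]
    rw [e]
    exact ContinuousMap.coeFn_toLp _ _
  have h1 : Tendsto (fun K => eLpNorm (⇑(p K) - F) 2 (AddCircle.haarAddCircle (T := 2 * Real.pi)))
      atTop (𝓝 0) := by
    refine (Lp.tendsto_Lp_iff_tendsto_eLpNorm'' _ hpL _ hF).1 ?_
    exact hsum.congr hps
  -- The factor √(2π) converts the L² norm for normalised Haar measure into the one for Lebesgue
  -- measure on (-π, π].
  have h2 : Tendsto (fun K => ENNReal.ofReal (2 * Real.pi) ^ (1 / 2 : ℝ) *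
      eLpNorm (⇑(p K) - F) 2 (AddCircle.haarAddCircle (T := 2 * Real.pi))) atTop (𝓝 0) := by
    simpa using ENNReal.Tendsto.const_mul (a := ENNReal.ofReal (2 * Real.pi) ^ (1 / 2 : ℝ)) h1
      (Or.inr (ENNReal.rpow_ne_top_of_nonneg (by norm_num) ENNReal.ofReal_ne_top))
  refine h2.congr fun K => ?_
  have h3 := eLpNorm_smul_measure_of_ne_top (p := 2) (by norm_num) (⇑(p K) - F)
    (ENNReal.ofReal (2 * Real.pi)) (μ := AddCircle.haarAddCircle (T := 2 * Real.pi))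
  rw [← AddCircle.volume_eq_smul_haarAddCircle] at h3
  have hmp := AddCircle.measurePreserving_mk (2 * Real.pi) (-Real.pi)
  rw [hend] at hmp
  rw [← eLpNorm_comp_measurePreserving
    ((p K).continuous.aestronglyMeasurable.sub hFv.1) hmp] at h3
  rw [show ((1 / 2 : ℝ)) = (1 / (2 : ℝ≥0∞)).toReal by norm_num, ← smul_eq_mul, ← h3]
  refine eLpNorm_congr_ae ?_
  filter_upwards [ae_restrict_mem measurableSet_Ioc] with w hw
  simp only [Function.comp, Pi.sub_apply]
  rw [hlift w hw]
  congr 1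
  simp only [p, ContinuousMap.sum_apply, ContinuousMap.smul_apply, hexp, smul_eq_mul]
  refine Finset.sum_nbij' (fun k => -k) (fun k => -k) ?_ ?_ (by simp) (by simp) ?_
  · intro k hk; rw [Finset.mem_Icc] at hk ⊢; omega
  · intro k hk; rw [Finset.mem_Icc] at hk ⊢; omega
  · intro k _
    simp

lemma isFourierTransform_idealLowPass {L : ℝ} (hL : 1 ≤ L) :
    IsFourierTransform (idealLowPass L)
      ((Set.Icc (-(Real.pi / L)) (Real.pi / L)).indicator fun _ => (1 : ℂ)) := by
  refine isFourierTransform_of_coeff ?_ fun k => ?_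
  · exact (memLp_const (1 : ℂ)).indicator measurableSet_Icc
  -- The impulse response is defined by the cosine alone; the sine part of the exponential is odd
  -- and integrates to 0 over the symmetric band.
  · have hodd : ∫ w in (-(Real.pi / L))..(Real.pi / L), Real.sin (k * w) = 0 := by
      have h := intervalIntegral.integral_comp_neg (a := -(Real.pi / L)) (b := Real.pi / L)
        (fun w => Real.sin (k * w))
      simp only [mul_neg, Real.sin_neg, intervalIntegral.integral_neg, neg_neg] at h
      linarith
    have hind : ∀ w : ℝ, (Set.Icc (-(Real.pi / L)) (Real.pi / L)).indicator (fun _ => (1 : ℂ)) w *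
        Complex.exp (Complex.I * w * (k : ℂ)) = (Set.Icc (-(Real.pi / L)) (Real.pi / L)).indicator
          (fun w : ℝ => Complex.exp (Complex.I * w * (k : ℂ))) w := by
      intro w
      by_cases hw : w ∈ Set.Icc (-(Real.pi / L)) (Real.pi / L)
      · simp only [Set.indicator_of_mem hw, one_mul]
      · simp only [Set.indicator_of_notMem hw, zero_mul]
    have hexp : ∀ w : ℝ, Complex.exp (Complex.I * w * (k : ℂ)) =
        ((Real.cos (k * w) : ℝ) : ℂ) + ((Real.sin (k * w) : ℝ) : ℂ) * Complex.I := by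
      intro w
      rw [show Complex.I * w * (k : ℂ) = ((k * w : ℝ) : ℂ) * Complex.I by push_cast; ring,
        Complex.exp_mul_I, Complex.ofReal_cos, Complex.ofReal_sin]
    simp_rw [hind]
    rw [setIntegral_indicator_band hL]
    simp_rw [hexp]
    rw [intervalIntegral.integral_add (Continuous.intervalIntegrable (by fun_prop) _ _)
      (Continuous.intervalIntegrable (by fun_prop) _ _), intervalIntegral.integral_mul_const,
      intervalIntegral.integral_ofReal, intervalIntegral.integral_ofReal, hodd, idealLowPass]
    push_cast
    simp


/-! ### Infinite filters and the mean-squared error of reconstruction -/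

lemma integral_circleMeasure {E : Type*} [NormedAddCommGroup E] [NormedSpace ℝ E] (f : ℝ → E) :
    ∫ w, f w ∂circleMeasure =
      (1 / (2 * Real.pi)) • ∫ w in Set.Ioc (-Real.pi) Real.pi, f w := by
  have := Real.pi_pos
  rw [circleMeasure, integral_smul_measure, ENNReal.toReal_ofReal (by positivity)]

instance : IsFiniteMeasure circleMeasure := by
  unfold circleMeasure; exact Measure.smul_finite _ ENNReal.ofReal_ne_top

lemma circleMeasure_absolutelyContinuous :
    circleMeasure ≪ volume.restrict (Set.Ioc (-Real.pi) Real.pi) :=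
  Measure.smul_absolutelyContinuous

lemma memLp_circleMeasure {f : ℝ → ℂ} {p : ℝ≥0∞}
    (hf : MemLp f p (volume.restrict (Set.Ioc (-Real.pi) Real.pi))) : MemLp f p circleMeasure :=
  hf.smul_measure ENNReal.ofReal_ne_top

lemma integrable_circleMeasure {f : ℝ → ℝ}
    (hf : IntegrableOn f (Set.Ioc (-Real.pi) Real.pi)) : Integrable f circleMeasure :=
  hf.smul_measure ENNReal.ofReal_ne_top

section Filtering

variable {Ω : Type*} [MeasurableSpace Ω] {P : Measure Ω}

namespace HasSpectralMeasure

lemma integral_sq_sum {Z : ℤ → Ω → ℝ} {μ : Measure ℝ} [IsFiniteMeasure μ]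
    (hZ : HasSpectralMeasure P Z μ) (s : Finset ℤ) (a : ℤ → ℝ) (n : ℤ) :
    ∫ x, (∑ k ∈ s, a k * Z (n - k) x) ^ 2 ∂P =
      ∫ w, ‖trigSum s (fun k => (a k : ℂ)) w‖ ^ 2 ∂μ := by
  have h := hZ.eLpNorm_sum s a n
  rw [eLpNorm_two_eq (hZ.memLp_sum s a n), eLpNorm_two_eq (memLp_trigSum s _ μ 2),
    ENNReal.ofReal_eq_ofReal_iff (Real.sqrt_nonneg _) (Real.sqrt_nonneg _),
    Real.sqrt_inj (integral_nonneg fun _ => by positivity)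
      (integral_nonneg fun _ => by positivity)] at h
  simpa using h

lemma add {X W : ℤ → Ω → ℝ} {μ ν : Measure ℝ} [IsFiniteMeasure μ] [IsFiniteMeasure ν]
    (hX : HasSpectralMeasure P X μ) (hW : HasSpectralMeasure P W ν)
    (hXW : ∀ i j, ∫ x, X i x * W j x ∂P = 0) :
    HasSpectralMeasure P (fun n x => X n x + W n x) (μ + ν) := by
  refine ⟨fun n => (hX.memLp n).add (hW.memLp n), fun i j => ?_⟩
  have hexp : ∀ (m : Measure ℝ) [IsFiniteMeasure m],
      Integrable (fun w : ℝ => Complex.exp (Complex.I * w * ((i - j : ℤ) : ℂ))) m := by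
    intro m _
    simpa using integrable_mul_exp (μ := m) (integrable_const (1 : ℂ)) (i - j)
  rw [integral_add_measure (hexp μ) (hexp ν), ← hX.covariance, ← hW.covariance,
    ← Complex.ofReal_add]
  congr 1
  have e : ∀ x, (X i x + W i x) * (X j x + W j x) =
      (X i x * X j x + X i x * W j x) + (X j x * W i x + W i x * W j x) := fun x => by ring
  have m1 := (hX.memLp i).integrable_mul (hX.memLp j)
  have m2 := (hX.memLp i).integrable_mul (hW.memLp j)
  have m3 := (hX.memLp j).integrable_mul (hW.memLp i)
  have m4 := (hW.memLp i).integrable_mul (hW.memLp j)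
  simp_rw [e]
  rw [integral_add (by exact m1.add m2) (by exact m3.add m4), integral_add (by exact m1)
    (by exact m2), integral_add (by exact m3) (by exact m4), hXW, hXW]
  ring

/-- If the symmetric partial sums of a filter converge in mean square, then the partial sums of its
transfer function converge in `L²` of the spectral measure, to the same limit as in
`L²(-π, π]`. -/
lemma tendsto_trigSum {Y Z : ℤ → Ω → ℝ} {μ : Measure ℝ} [IsFiniteMeasure μ]
    (hY : HasSpectralMeasure P Y μ)
    (hμ : μ ≪ volume.restrict (Set.Ioc (-Real.pi) Real.pi)) {h : ℤ → ℝ} {H : ℝ → ℂ}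
    (hH : IsFourierTransform h H) (hZ : IsFilterOutput P h Y Z) :
    Tendsto (fun K : ℕ => eLpNorm (fun w =>
      trigSum (Finset.Icc (-(K : ℤ)) K) (fun k => (h k : ℂ)) w - H w) 2 μ) atTop (𝓝 0) := by
  let I : ℕ → Finset ℤ := fun K => Finset.Icc (-(K : ℤ)) K
  let T : ℕ → ℝ → ℂ := fun K => trigSum (I K) (fun k => (h k : ℂ))
  let s : ℕ → Ω → ℝ := fun K x => ∑ k ∈ I K, h k * Y (0 - k) x
  have hs : ∀ K, MemLp (s K) 2 P := fun K => hY.memLp_sum _ _ _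
  have hZL := (hZ 0).1
  have hZlim : Tendsto (fun K => eLpNorm (fun x => s K x - Z 0 x) 2 P) atTop (𝓝 0) := (hZ 0).2
  have hTm : ∀ K, Measurable (T K) := fun K => (continuous_trigSum _ _).measurable
  -- The density of μ may be unbounded, so L²(-π, π] convergence does not by itself give L²(μ)
  -- convergence. It does give a subsequence converging a.e., hence μ-a.e., which identifies the
  -- limit as H.
  have hmeas : TendstoInMeasure (volume.restrict (Set.Ioc (-Real.pi) Real.pi)) T atTop H :=
    tendstoInMeasure_of_tendsto_eLpNorm (p := 2) (by norm_num)
      (fun K => (hTm K).aestronglyMeasurable) hH.1.1 hH.2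
  obtain ⟨ns, hns, hae⟩ := hmeas.exists_seq_tendsto_ae
  have haeμ := hμ.ae_le hae
  -- The difference of two partial sums is a finite filter, so the isometry transfers the Cauchy
  -- property from the outputs. Fatou's lemma along the subsequence then replaces T K by H.
  have hdiff : ∀ J K, J ≤ K → eLpNorm (fun w => T J w - T K w) 2 μ ≤
      eLpNorm (fun x => s J x - Z 0 x) 2 P + eLpNorm (fun x => s K x - Z 0 x) 2 P := by
    intro J K hJK
    have hsub : I J ⊆ I K := Finset.Icc_subset_Icc (by omega) (by omega)
    have h1 : eLpNorm (fun w => T J w - T K w) 2 μ =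
        eLpNorm (trigSum (I K \ I J) (fun k => (h k : ℂ))) 2 μ := by
      refine eLpNorm_congr_norm_ae (ae_of_all _ fun w => ?_)
      rw [norm_sub_rev]
      simp only [T, trigSum]
      rw [← Finset.sum_sdiff hsub, add_sub_cancel_right]
    have h2 : (fun x => ∑ k ∈ I K \ I J, h k * Y (0 - k) x) =
        (fun x => s K x - Z 0 x) - (fun x => s J x - Z 0 x) := by
      funext x
      simp only [s, Pi.sub_apply]
      rw [← Finset.sum_sdiff hsub]; ring
    rw [h1, ← hY.eLpNorm_sum _ _ 0, h2, add_comm]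
    exact eLpNorm_sub_le ((hs K).1.sub hZL.1) ((hs J).1.sub hZL.1) (by norm_num)
  refine tendsto_of_tendsto_of_tendsto_of_le_of_le tendsto_const_nhds hZlim
    (fun _ => zero_le) fun J => ?_
  have hfm : ∀ j, AEStronglyMeasurable (fun w => T J w - T (ns j) w) μ := fun j =>
    ((hTm J).sub (hTm _)).aestronglyMeasurable
  have hfl : ∀ᵐ w ∂μ, Tendsto (fun j => T J w - T (ns j) w) atTop (𝓝 (T J w - H w)) := by
    filter_upwards [haeμ] with w hw
    exact tendsto_const_nhds.sub hw
  change eLpNorm (fun w => T J w - H w) 2 μ ≤ eLpNorm (fun x => s J x - Z 0 x) 2 P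
  clear_value T s
  have hfatou : eLpNorm (fun w => T J w - H w) 2 μ ≤
      liminf (fun j => eLpNorm (fun w => T J w - T (ns j) w) 2 μ) atTop := by
    exact Lp.eLpNorm_lim_le_liminf_eLpNorm hfm _ hfl
  refine hfatou.trans ?_
  have hlim : Tendsto (fun j => eLpNorm (fun x => s J x - Z 0 x) 2 P +
      eLpNorm (fun x => s (ns j) x - Z 0 x) 2 P) atTop
      (𝓝 (eLpNorm (fun x => s J x - Z 0 x) 2 P)) := by
    simpa using tendsto_const_nhds.add (hZlim.comp hns.tendsto_atTop)
  rw [← hlim.liminf_eq]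
  refine liminf_le_liminf ?_
  filter_upwards [eventually_ge_atTop J] with j hj
  exact hdiff J (ns j) (hj.trans (hns.id_le j))

/-- Mean-squared error of the reconstruction of `X` from `X + W` by a linear filter with transfer
function `H`. -/
lemma integral_sq_sub_filterOutput {X W Z : ℤ → Ω → ℝ} {μ ν : Measure ℝ} [IsFiniteMeasure μ]
    [IsFiniteMeasure ν] (hX : HasSpectralMeasure P X μ) (hW : HasSpectralMeasure P W ν)
    (hXW : ∀ i j, ∫ x, X i x * W j x ∂P = 0)
    (hμ : μ ≪ volume.restrict (Set.Ioc (-Real.pi) Real.pi))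
    (hν : ν ≪ volume.restrict (Set.Ioc (-Real.pi) Real.pi)) {h : ℤ → ℝ} {H : ℝ → ℂ}
    (hH : IsFourierTransform h H) (hHm : MemLp H 2 (μ + ν))
    (hZ : IsFilterOutput P h (fun n x => X n x + W n x) Z) (n : ℤ) :
    ∫ x, (X n x - Z n x) ^ 2 ∂P = ∫ w, ‖1 - H w‖ ^ 2 ∂μ + ∫ w, ‖H w‖ ^ 2 ∂ν := by
  have hlim := (hX.add hW hXW).tendsto_trigSum (hμ.add_left hν) hH hZ
  have hle : μ ≤ μ + ν := Measure.le_add_right le_rfl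
  have hle' : ν ≤ μ + ν := Measure.le_add_left le_rfl
  let I : ℕ → Finset ℤ := fun K => Finset.Icc (-(K : ℤ)) K
  let T : ℕ → ℝ → ℂ := fun K => trigSum (I K) (fun k => (h k : ℂ))
  have hlimμ : Tendsto (fun K => eLpNorm (fun w => T K w - H w) 2 μ) atTop (𝓝 0) :=
    tendsto_of_tendsto_of_tendsto_of_le_of_le tendsto_const_nhds hlim (fun _ => zero_le)
      fun K => eLpNorm_mono_measure _ hle
  have hlimν : Tendsto (fun K => eLpNorm (fun w => T K w - H w) 2 ν) atTop (𝓝 0) :=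
    tendsto_of_tendsto_of_tendsto_of_le_of_le tendsto_const_nhds hlim (fun _ => zero_le)
      fun K => eLpNorm_mono_measure _ hle'
  have hTμ : ∀ K, MemLp (T K) 2 μ := fun K => memLp_trigSum _ _ μ 2
  have hTν : ∀ K, MemLp (T K) 2 ν := fun K => memLp_trigSum _ _ ν 2
  have sqlim : ∀ {m : Measure ℝ} [IsFiniteMeasure m] {f : ℕ → ℝ → ℂ} {g : ℝ → ℂ},
      (∀ K, MemLp (f K) 2 m) → MemLp g 2 m →
      Tendsto (fun K => eLpNorm (fun w => f K w - g w) 2 m) atTop (𝓝 0) →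
      Tendsto (fun K => ∫ w, ‖f K w‖ ^ 2 ∂m) atTop (𝓝 (∫ w, ‖g w‖ ^ 2 ∂m)) := by
    intro m _ f g hf hg hfg
    have h1 := tendsto_integral_mul_conj (𝕜 := ℂ) hf hg hf hg hfg hfg
    have e : ∀ u : ℝ → ℂ, ∫ w, u w * (starRingEnd ℂ) (u w) ∂m =
        ((∫ w, ‖u w‖ ^ 2 ∂m : ℝ) : ℂ) := by
      intro u
      rw [← integral_complex_ofReal]
      simp [Complex.mul_conj']
    simp_rw [e] at h1
    exact_mod_cast (Complex.continuous_re.tendsto _).comp h1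
  have l1 : Tendsto (fun K => ∫ w, ‖1 - T K w‖ ^ 2 ∂μ) atTop (𝓝 (∫ w, ‖1 - H w‖ ^ 2 ∂μ)) := by
    refine sqlim (fun K => (memLp_const 1).sub (hTμ K))
      ((memLp_const 1).sub (hHm.mono_measure hle)) (hlimμ.congr fun K => ?_)
    refine eLpNorm_congr_norm_ae (ae_of_all _ fun w => ?_)
    rw [← norm_neg]; congr 1; ring
  have l2 : Tendsto (fun K => ∫ w, ‖T K w‖ ^ 2 ∂ν) atTop (𝓝 (∫ w, ‖H w‖ ^ 2 ∂ν)) :=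
    sqlim hTν (hHm.mono_measure hle') hlimν
  -- The error X - h * (X + W) equals (δ - h) * X - h * W, and the two terms are orthogonal.
  let d : ℤ → ℝ := fun k => (if k = 0 then 1 else 0) - h k
  let A : ℕ → Ω → ℝ := fun K x => ∑ k ∈ I K, d k * X (n - k) x
  let B : ℕ → Ω → ℝ := fun K x => ∑ k ∈ I K, h k * W (n - k) x
  have hA : ∀ K, MemLp (A K) 2 P := fun K => hX.memLp_sum _ _ _
  have hB : ∀ K, MemLp (B K) 2 P := fun K => hW.memLp_sum _ _ _
  have hAX : ∀ K x, A K x = X n x - ∑ k ∈ I K, h k * X (n - k) x := by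
    intro K x
    simp only [A, d, sub_mul, Finset.sum_sub_distrib]
    congr 1
    rw [Finset.sum_eq_single 0]
    · simp
    · intro k _ hk; simp [hk]
    · intro h; simp [I] at h
  have hTd : ∀ K w, trigSum (I K) (fun k => (d k : ℂ)) w = 1 - T K w := by
    intro K w
    simp only [T, trigSum, d, Complex.ofReal_sub, sub_mul, Finset.sum_sub_distrib]
    congr 1
    rw [Finset.sum_eq_single 0]
    · simp
    · intro k _ hk; simp [hk]
    · intro h; simp [I] at h
  have hAB : ∀ K, ∫ x, A K x * B K x ∂P = 0 := by
    intro K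
    have hi : ∀ k l, Integrable (fun x => d k * X (n - k) x * (h l * W (n - l) x)) P := fun k l =>
      ((hX.memLp (n - k)).const_mul (d k)).integrable_mul ((hW.memLp (n - l)).const_mul (h l))
    simp only [A, B, Finset.sum_mul_sum]
    rw [integral_finsetSum _ fun k _ => integrable_finsetSum _ fun l _ => hi k l]
    refine Finset.sum_eq_zero fun k _ => ?_
    rw [integral_finsetSum _ fun l _ => hi k l]
    refine Finset.sum_eq_zero fun l _ => ?_
    have e : ∀ x, d k * X (n - k) x * (h l * W (n - l) x) =
        d k * h l * (X (n - k) x * W (n - l) x) := fun x => by ring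
    simp_rw [e]
    rw [integral_const_mul, hXW, mul_zero]
  have henergy : ∀ K, ∫ x, (A K x - B K x) * (A K x - B K x) ∂P =
      ∫ w, ‖1 - T K w‖ ^ 2 ∂μ + ∫ w, ‖T K w‖ ^ 2 ∂ν := by
    intro K
    have h1 := hX.integral_sq_sum (I K) d n
    have h2 := hW.integral_sq_sum (I K) h n
    simp_rw [hTd] at h1
    rw [← h1, ← h2]
    have e : ∀ x, (A K x - B K x) * (A K x - B K x) =
        A K x ^ 2 - 2 * (A K x * B K x) + B K x ^ 2 := fun x => by ring
    have i1 := (hA K).integrable_sq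
    have i2 := ((hA K).integrable_mul (hB K)).const_mul 2
    have i3 := (hB K).integrable_sq
    simp_rw [e]
    rw [integral_add (by exact i1.sub i2) i3, integral_sub i1 (by exact i2), integral_const_mul,
      hAB]
    simp [A, B]
  obtain ⟨hZL, hZlim⟩ := hZ n
  have hABlim : Tendsto (fun K => eLpNorm (fun x => (A K x - B K x) - (X n x - Z n x)) 2 P)
      atTop (𝓝 0) := by
    refine hZlim.congr fun K => eLpNorm_congr_norm_ae (ae_of_all _ fun x => ?_)
    rw [hAX, ← norm_neg]
    congr 1
    simp only [B, mul_add, Finset.sum_add_distrib, I]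
    ring
  have hm : ∀ K, MemLp (fun x => A K x - B K x) 2 P := fun K => (hA K).sub (hB K)
  have hm' : MemLp (fun x => X n x - Z n x) 2 P := (hX.memLp n).sub hZL
  have hfin := tendsto_integral_mul hm hm' hm hm' hABlim hABlim
  simp_rw [henergy] at hfin
  have := tendsto_nhds_unique hfin (l1.add l2)
  simpa [pow_two] using this

end HasSpectralMeasure

end Filtering

/-! ### Second moments of the test channel -/

lemma tendsto_eLpNorm_two_smul_measure {α E : Type*} [MeasurableSpace α] [NormedAddCommGroup E]
    {μ : Measure α} {f : ℕ → α → E} (hf : Tendsto (fun K => eLpNorm (f K) 2 μ) atTop (𝓝 0))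
    {c : ℝ≥0∞} (hc : c ≠ ∞) : Tendsto (fun K => eLpNorm (f K) 2 (c • μ)) atTop (𝓝 0) := by
  have h := ENNReal.Tendsto.const_mul (a := c ^ (1 / (2 : ℝ≥0∞)).toReal) hf
    (Or.inr (ENNReal.rpow_ne_top_of_nonneg (by norm_num) hc))
  rw [mul_zero] at h
  refine h.congr fun K => ?_
  rw [eLpNorm_smul_measure_of_ne_top (by norm_num), smul_eq_mul]

lemma sum_delta_sub_mul {R : Type*} [CommRing R] (K : ℕ) (c u : ℤ → R) :
    ∑ k ∈ Finset.Icc (-(K : ℤ)) K, ((if k = 0 then 1 else 0) - c k) * u k =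
      u 0 - ∑ k ∈ Finset.Icc (-(K : ℤ)) K, c k * u k := by
  simp only [sub_mul, Finset.sum_sub_distrib]
  congr 1
  rw [Finset.sum_eq_single 0]
  · simp
  · intro k _ hk; simp [hk]
  · intro h; simp at h

/-- The transfer function of the filter `δ - c` is `1 - C`. -/
lemma IsFourierTransform.delta_sub {c : ℤ → ℝ} {C : ℝ → ℂ} (hC : IsFourierTransform c C) :
    IsFourierTransform (fun k => (if k = 0 then 1 else 0) - c k) (fun w => 1 - C w) := by
  refine ⟨(memLp_const 1).sub hC.1, hC.2.congr fun K => ?_⟩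
  refine eLpNorm_congr_norm_ae (ae_of_all _ fun w => ?_)
  have := sum_delta_sub_mul K (fun k => (c k : ℂ))
    (fun k => Complex.exp (-(Complex.I * (w : ℂ) * (k : ℂ))))
  have h0 : ∀ k : ℤ, ((if k = 0 then 1 else 0 : ℝ) : ℂ) = if k = 0 then 1 else 0 := fun k => by
    split_ifs <;> simp
  simp only [Complex.ofReal_sub, h0]
  rw [this, ← norm_neg]
  congr 1
  simp

section Filtering

variable {Ω : Type*} [MeasurableSpace Ω] {P : Measure Ω}

lemma IsFilterOutput.delta_sub {c : ℤ → ℝ} {N F : ℤ → Ω → ℝ} (hN : ∀ n, MemLp (N n) 2 P)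
    (hF : IsFilterOutput P c N F) :
    IsFilterOutput P (fun k => (if k = 0 then 1 else 0) - c k) N (fun n x => N n x - F n x) := by
  intro n
  refine ⟨(hN n).sub (hF n).1, (hF n).2.congr fun K => ?_⟩
  refine eLpNorm_congr_norm_ae (ae_of_all _ fun x => ?_)
  rw [sum_delta_sub_mul K c (fun k => N (n - k) x), ← norm_neg]
  congr 1
  simp

/-- A band-limited stationary Gaussian process has a spectral measure concentrated on the band. -/
lemma IsBandLimitedGaussian.exists_spectralMeasure [IsProbabilityMeasure P] {L varX : ℝ}
    {X : ℤ → Ω → ℝ} (hX : IsBandLimitedGaussian P L varX X) :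
    ∃ μ : Measure ℝ, IsFiniteMeasure μ ∧ HasSpectralMeasure P X μ ∧
      μ ≪ volume.restrict (Set.Ioc (-Real.pi) Real.pi) ∧
      ∀ᵐ w ∂μ, w ∈ Set.Icc (-(Real.pi / L)) (Real.pi / L) := by
  obtain ⟨S, ⟨hSi, hSR⟩, hSband⟩ := hX.band_limited
  have hpi := Real.pi_pos
  have hXL : ∀ n, MemLp (X n) 2 P := fun n => (hX.gaussian.hasGaussianLaw_eval n).memLp_two
  have hSc : Integrable S circleMeasure := integrable_circleMeasure hSi
  have hcov : ∀ i j : ℤ, ((∫ x, X i x * X j x ∂P : ℝ) : ℂ) =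
      ∫ w : ℝ, (S w : ℂ) * Complex.exp (Complex.I * w * ((i - j : ℤ) : ℂ)) ∂circleMeasure := by
    intro i j
    have h1 := ((hX.stationary j).comp (u := fun y : ℤ → ℝ => y (i - j) * y 0)
      (by fun_prop)).integral_eq
    simp only [Function.comp_def, sub_add_cancel, zero_add] at h1
    rw [h1, integral_circleMeasure]
    have h2 := hSR (i - j)
    rw [autocorrelation, intervalIntegral.integral_of_le (by linarith)] at h2
    rw [h2, Complex.real_smul]
    push_cast
    rfl
  -- `IsPSD` does not include S ≥ 0; it is deduced from E |∑ z_k X_{-k}|² ≥ 0 for all finite complex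
  -- combinations.
  have hpos : ∀ᵐ w ∂(volume.restrict (Set.Ioc (-Real.pi) Real.pi)), 0 ≤ S w := by
    refine ae_nonneg_of_forall_trigSum hSi fun s z => ?_
    have h := integral_filter_mul_conj (g := fun w => (S w : ℂ)) hXL hSc.ofReal hcov s z 0 0
    simp only [sub_self, Int.cast_zero, mul_zero, Complex.exp_zero, mul_one,
      Complex.mul_conj'] at h
    have e1 : ∀ x, (‖∑ k ∈ s, z k * (X (0 - k) x : ℂ)‖ ^ 2 : ℂ) =
        ((‖∑ k ∈ s, z k * (X (0 - k) x : ℂ)‖ ^ 2 : ℝ) : ℂ) := fun x => by push_cast; rfl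
    have e2 : ∀ w, (S w : ℂ) * (‖trigSum s z w‖ ^ 2 : ℂ) =
        ((S w * ‖trigSum s z w‖ ^ 2 : ℝ) : ℂ) := fun w => by push_cast; rfl
    simp_rw [e1, e2] at h
    rw [integral_complex_ofReal, integral_complex_ofReal, Complex.ofReal_inj,
      integral_circleMeasure, smul_eq_mul] at h
    have h0 : 0 ≤ ∫ x, ‖∑ k ∈ s, z k * (X (0 - k) x : ℂ)‖ ^ 2 ∂P :=
      integral_nonneg fun x => by positivity
    rw [h] at h0
    exact nonneg_of_mul_nonneg_right h0 (by positivity)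
  have hposc := circleMeasure_absolutelyContinuous.ae_le hpos
  refine ⟨circleMeasure.withDensity fun w => ENNReal.ofReal (S w),
    isFiniteMeasure_withDensity_ofReal hSc.2, ⟨hXL, fun i j => ?_⟩,
    (withDensity_absolutelyContinuous _ _).trans circleMeasure_absolutelyContinuous, ?_⟩
  · rw [integral_withDensity_eq_integral_toReal_smul₀ hSc.1.aemeasurable.ennreal_ofReal
      (ae_of_all _ fun w => ENNReal.ofReal_lt_top), hcov]
    refine integral_congr_ae ?_
    filter_upwards [hposc] with w hw
    rw [ENNReal.toReal_ofReal hw, Complex.real_smul]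
  · rw [ae_withDensity_iff' hSc.1.aemeasurable.ennreal_ofReal]
    have hmem := circleMeasure_absolutelyContinuous.ae_le
      (ae_restrict_mem (μ := volume) (measurableSet_Ioc (a := -Real.pi) (b := Real.pi)))
    filter_upwards [hmem] with w hw hne
    by_contra hband
    exact hne (by rw [hSband w hw hband, ENNReal.ofReal_zero])

lemma hasSpectralMeasure_delta_sub [IsProbabilityMeasure P] {N F : ℤ → Ω → ℝ} {v : ℝ≥0}
    (hN : ∀ n, HasLaw (N n) (gaussianReal 0 v) P) (hNi : iIndepFun N P) {c : ℤ → ℝ} {C : ℝ → ℂ}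
    (hC : IsFourierTransform c C) (hF : IsFilterOutput P c N F) :
    HasSpectralMeasure P (fun n x => N n x - F n x)
      (((v : ℝ≥0∞) • circleMeasure).withDensity fun w => ENNReal.ofReal (‖1 - C w‖ ^ 2)) := by
  have hW := hasSpectralMeasure_whiteNoise hN hNi
  have : IsFiniteMeasure ((v : ℝ≥0∞) • circleMeasure) :=
    Measure.smul_finite _ ENNReal.coe_ne_top
  refine hW.filterOutput (a := fun k => (if k = 0 then 1 else 0) - c k)
    ((memLp_circleMeasure hC.delta_sub.1).smul_measure ENNReal.coe_ne_top) ?_ (hF.delta_sub hW.memLp)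
  exact tendsto_eLpNorm_two_smul_measure (tendsto_eLpNorm_two_smul_measure hC.delta_sub.2
    ENNReal.ofReal_ne_top) ENNReal.coe_ne_top

/-- Every partial sum is orthogonal to X by independence and zero mean of the noise, and
orthogonality survives mean-square limits. Hence source and shaped noise contribute separately to
all second moments. -/
lemma integral_mul_sub_filterOutput_eq_zero [IsProbabilityMeasure P] {X : Ω → ℝ}
    {N F : ℤ → Ω → ℝ} (hX : MemLp X 2 P) (hN : ∀ n, MemLp (N n) 2 P)
    (hN0 : ∀ n, ∫ x, N n x ∂P = 0) (hXN : ∀ n, IndepFun X (N n) P) {c : ℤ → ℝ}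
    (hF : IsFilterOutput P c N F) (n : ℤ) :
    ∫ x, X x * (N n x - F n x) ∂P = 0 := by
  obtain ⟨hWL, hWlim⟩ := hF.delta_sub hN n
  set b : ℤ → ℝ := fun k => (if k = 0 then 1 else 0) - c k
  refine tendsto_nhds_unique (tendsto_integral_mul (fun _ => hX) hX
    (fun K => memLp_finsetSum _ fun k _ => (hN (n - k)).const_mul (b k)) hWL (by simp) hWlim) ?_
  have e : ∀ K : ℕ,
      ∫ x, X x * ∑ k ∈ Finset.Icc (-(K : ℤ)) K, b k * N (n - k) x ∂P = 0 := by
    intro K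
    simp only [Finset.mul_sum, mul_left_comm (X _)]
    rw [integral_finsetSum _ fun k _ => Integrable.const_mul (by exact hX.integrable_mul (hN _)) _]
    refine Finset.sum_eq_zero fun k _ => ?_
    rw [integral_const_mul, (hXN _).integral_fun_mul_eq_mul_integral hX.1 (hN _).1, hN0, mul_zero,
      mul_zero]
  simp [e]

lemma integral_withDensity_circleMeasure {v : ℝ≥0} {A : ℝ → ℂ}
    (hA : MemLp A 2 (volume.restrict (Set.Ioc (-Real.pi) Real.pi))) (f : ℝ → ℝ) :
    ∫ w, f w ∂(((v : ℝ≥0∞) • circleMeasure).withDensity fun w => ENNReal.ofReal (‖A w‖ ^ 2)) =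
      v * (1 / (2 * Real.pi) * ∫ w in Set.Ioc (-Real.pi) Real.pi, ‖A w‖ ^ 2 * f w) := by
  have hAm : AEMeasurable (fun w => ENNReal.ofReal (‖A w‖ ^ 2)) ((v : ℝ≥0∞) • circleMeasure) :=
    ((hA.1.norm.aemeasurable.pow_const 2).ennreal_ofReal).mono_ac
      (Measure.smul_absolutelyContinuous.trans circleMeasure_absolutelyContinuous)
  rw [integral_withDensity_eq_integral_toReal_smul₀ hAm
    (ae_of_all _ fun w => ENNReal.ofReal_lt_top), integral_smul_measure, integral_circleMeasure]
  simp

/-- Second-order description of the test channel: the distortion is the noise power passed by the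
low-pass filter, and the variance of the channel input follows from the spectral shape. -/
lemma channel_second_moments [IsProbabilityMeasure P] {L varX : ℝ} (hL : 1 ≤ L) {v : ℝ≥0}
    {c : ℤ → ℝ} {C : ℝ → ℂ} (hC : IsFourierTransform c C) {X N U Xhat : ℤ → Ω → ℝ}
    (hX : IsBandLimitedGaussian P L varX X) (hch : IsTestChannel P L v c X N U Xhat) (n : ℤ) :
    ∫ x, (X n x - Xhat n x) ^ 2 ∂P = v * (1 / (2 * Real.pi) *
      ∫ w in (-(Real.pi / L))..(Real.pi / L), ‖1 - C w‖ ^ 2) ∧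
    ∫ x, (U n x + N n x) ^ 2 ∂P = varX + v * (1 / (2 * Real.pi) *
      ∫ w in Set.Ioc (-Real.pi) Real.pi, ‖1 - C w‖ ^ 2) := by
  obtain ⟨F, hF, hU⟩ := hch.feedback
  obtain ⟨μ, hμf, hXμ, hμ, hμband⟩ := hX.exists_spectralMeasure
  have hN := hch.noise.law
  have hNL : ∀ n, MemLp (N n) 2 P := fun n => (hN n).hasGaussianLaw.memLp_two
  have hN0 : ∀ n, ∫ x, N n x ∂P = 0 := fun n => by rw [(hN n).integral_eq]; simp
  have hW := hasSpectralMeasure_delta_sub hN hch.noise.iid hC hF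
  have h1C := hC.delta_sub.1
  set ν := ((v : ℝ≥0∞) • circleMeasure).withDensity fun w => ENNReal.ofReal (‖1 - C w‖ ^ 2)
    with hν
  have hvf : IsFiniteMeasure ((v : ℝ≥0∞) • circleMeasure) :=
    Measure.smul_finite _ ENNReal.coe_ne_top
  have hνf : IsFiniteMeasure ν := isFiniteMeasure_withDensity_ofReal
    (((integrable_circleMeasure h1C.norm.integrable_sq).smul_measure ENNReal.coe_ne_top).2)
  have hνac : ν ≪ volume.restrict (Set.Ioc (-Real.pi) Real.pi) :=
    (withDensity_absolutelyContinuous _ _).trans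
      (Measure.smul_absolutelyContinuous.trans circleMeasure_absolutelyContinuous)
  have hXN : ∀ i j, IndepFun (X i) (N j) P := fun i j =>
    hch.noise.indep_input.comp (φ := fun y : ℤ → ℝ => y i) (ψ := fun y : ℤ → ℝ => y j)
      (by fun_prop) (by fun_prop)
  have hXW : ∀ i j, ∫ x, X i x * (N j x - F j x) ∂P = 0 := fun i j =>
    integral_mul_sub_filterOutput_eq_zero (hXμ.memLp i) hNL hN0 (hXN i) hF j
  have hY : ∀ n x, U n x + N n x = X n x + (N n x - F n x) := fun n x => by rw [hU]; ring
  constructor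
  · have hrec := hch.reconstruction
    simp only [hY] at hrec
    rw [hXμ.integral_sq_sub_filterOutput hW hXW hμ hνac (isFourierTransform_idealLowPass hL)
      ((memLp_const (1 : ℂ)).indicator measurableSet_Icc) hrec n]
    -- The spectrum of X sits where the filter equals 1, so the source contributes nothing to the
    -- error.
    have z : ∫ w, ‖1 - (Set.Icc (-(Real.pi / L)) (Real.pi / L)).indicator (fun _ => (1 : ℂ)) w‖ ^ 2
        ∂μ = 0 := by
      rw [integral_eq_zero_of_ae]
      filter_upwards [hμband] with w hw
      simp [Set.indicator_of_mem hw]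
    rw [z, zero_add, hν, integral_withDensity_circleMeasure h1C,
      ← setIntegral_indicator_band hL (fun w => ‖1 - C w‖ ^ 2)]
    congr 3
    funext w
    by_cases hw : w ∈ Set.Icc (-(Real.pi / L)) (Real.pi / L)
    · simp [Set.indicator_of_mem hw]
    · simp [Set.indicator_of_notMem hw]
  · simp_rw [hY]
    have e : ∀ x, (X n x + (N n x - F n x)) ^ 2 =
        X n x ^ 2 + 2 * (X n x * (N n x - F n x)) + (N n x - F n x) ^ 2 := fun x => by ring
    simp_rw [e]
    have i1 := (hXμ.memLp n).integrable_sq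
    have i2 := ((hXμ.memLp n).integrable_mul (hW.memLp n)).const_mul 2
    have i3 := (hW.memLp n).integrable_sq
    rw [integral_add (by exact i1.add i2) i3, integral_add i1 (by exact i2), integral_const_mul,
      hXW, mul_zero, add_zero]
    congr 1
    · have := hX.variance_eq n
      rw [variance_eq_sub (hXμ.memLp n), hX.mean_zero] at this
      simpa using this
    -- The one-tap filter with coefficient 1 returns the shaped noise itself, so its power is the
    -- total mass of its spectral measure.
    · have h := hW.integral_sq_sum {0} (fun _ => 1) n
      simp only [Finset.sum_singleton, one_mul, sub_zero] at h
      rw [h, hν, integral_withDensity_circleMeasure h1C]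
      simp [trigSum]

end Filtering
end SigmaDelta

/-! ### The rate bound and its equality case -/

theorem corollary1 {Ω : Type*} [MeasurableSpace Ω] (P : Measure Ω) [IsProbabilityMeasure P]
    (L : ℝ) (hL : 1 ≤ L) (varX D : ℝ) (hD : 0 < D) (v : ℝ≥0)
    (c : ℤ → ℝ) (C : ℝ → ℂ) (hC : SigmaDelta.IsFourierTransform c C)
    (X N U Xhat : ℤ → Ω → ℝ)
    (hX : SigmaDelta.IsBandLimitedGaussian P L varX X)
    (hchannel : SigmaDelta.IsTestChannel P L v c X N U Xhat)
    (hMSE : ∀ n : ℤ, ∫ x, (X n x - Xhat n x) ^ 2 ∂P = D) :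
    ∀ n : ℤ,
      ENNReal.ofReal (1 / (2 * L) * Real.logb 2 (1 + varX / D)) ≤
          SigmaDelta.mutualInfo P (U n) (fun x => U n x + N n x) ∧
      (SigmaDelta.mutualInfo P (U n) (fun x => U n x + N n x) =
          ENNReal.ofReal (1 / (2 * L) * Real.logb 2 (1 + varX / D)) ↔
        (∀ᵐ w ∂(volume.restrict (Set.Ioc (-Real.pi) Real.pi)),
          (w ∈ Set.Icc (-(Real.pi / L)) (Real.pi / L) →
            ‖1 - C w‖ ^ 2 = (1 + varX / D) ^ (-(L - 1) / L)) ∧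
          (w ∉ Set.Icc (-(Real.pi / L)) (Real.pi / L) →
            ‖1 - C w‖ ^ 2 = (1 + varX / D) ^ (1 / L))) ∧
        (v : ℝ) = D / (1 / (2 * Real.pi) *
          ∫ w in (-(Real.pi / L))..(Real.pi / L), ‖1 - C w‖ ^ 2) ∧
        (v : ℝ) = L * D / (1 + varX / D) ^ (-(L - 1) / L)) := by
  intro n
  have hpi := Real.pi_pos
  have hL0 : 0 < L := by linarith
  obtain ⟨F, hF, hU⟩ := hchannel.feedback
  have hN := hchannel.noise.law
  have hc := hchannel.filter.causal
  obtain ⟨hmse, hpow⟩ := SigmaDelta.channel_second_moments hL hC hX hchannel n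
  rw [hMSE n] at hmse
  have hXg := hX.gaussian.hasGaussianLaw_eval n
  have hXN : IndepFun (X n) (fun x n => N n x) P :=
    hchannel.noise.indep_input.comp (φ := fun y : ℤ → ℝ => y n) (ψ := id) (by fun_prop)
      measurable_id
  obtain ⟨hUg, hU0, hUN⟩ := SigmaDelta.hasGaussianLaw_input_and_indepFun hXg (hX.mean_zero n) hN
    hchannel.noise.iid hXN (hc 0 le_rfl) hF n
  have hUfun : U n = fun x => X n x - F n x := funext fun x => hU n x
  rw [← hUfun] at hUg hUN
  simp_rw [← hU n] at hU0
  set I := ∫ w in (-(Real.pi / L))..(Real.pi / L), ‖1 - C w‖ ^ 2 with hI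
  set J := ∫ w in Set.Ioc (-Real.pi) Real.pi, ‖1 - C w‖ ^ 2 with hJ
  have hv : v ≠ 0 := by rintro rfl; simp at hmse; linarith
  have hv0 : (0 : ℝ) < v := by positivity
  have hNg := (hN n).hasGaussianLaw
  have hN0 : ∫ x, N n x ∂P = 0 := by rw [(hN n).integral_eq]; simp
  set s : ℝ≥0 := Var[U n; P].toNNReal with hs
  have hUlaw : P.map (U n) = gaussianReal 0 s := by
    rw [hUg.map_eq_gaussianReal, hU0]
  have hsval : (s : ℝ) + v = varX + v * (1 / (2 * Real.pi) * J) := by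
    rw [← hpow, hs, Real.coe_toNNReal _ (variance_nonneg _ _),
      ← (show Var[N n; P] = v by rw [(hN n).variance_eq]; simp),
      ← hUN.variance_add hUg.memLp_two hNg.memLp_two,
      variance_eq_sub (hUg.memLp_two.add hNg.memLp_two)]
    simp only [Pi.add_apply, Pi.pow_apply]
    rw [integral_add hUg.integrable hNg.integrable, hU0, hN0]
    simp
  have hvarX : 0 ≤ varX := by rw [← hX.variance_eq n]; exact variance_nonneg _ _
  set g := 1 + varX / D with hg
  have hg1 : 1 ≤ g := by rw [hg]; have := div_nonneg hvarX hD.le; linarith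
  have hg0 : 0 < g := by linarith
  -- The output power gives 1 + s/v = varX/v + J/(2π), and the distortion formula gives varX/v = (g
  -- - 1) I/(2π).
  have hsnr : 2 * Real.pi * (1 + s / v : ℝ) = (g - 1) * I + J := by
    have h1 : (1 + s / v : ℝ) = (varX + v * (1 / (2 * Real.pi) * J)) / v := by
      rw [← hsval]; field_simp; ring
    have h2 : g - 1 = varX / (v * (1 / (2 * Real.pi) * I)) := by rw [hg, ← hmse]; ring
    have hI0 : I ≠ 0 := by rintro h; rw [h] at hmse; simp at hmse; linarith
    rw [h1, h2]
    field_simp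
  obtain ⟨hbound, heq⟩ := SigmaDelta.weighted_energy_lower_bound hL hg0 hc hC
  rw [← hI, ← hJ, ← hsnr] at hbound heq
  have hlog2 : 0 < Real.log 2 := Real.log_pos (by norm_num)
  have hR1 : (1 : ℝ) ≤ 1 + s / v := by have : (0:ℝ) ≤ s / v := by positivity
                                       linarith
  have hinfo : SigmaDelta.mutualInfo P (U n) (fun x => U n x + N n x) =
      ENNReal.ofReal (1 / 2 * Real.logb 2 (1 + s / v)) := by
    rw [SigmaDelta.mutualInfo, SigmaDelta.klDiv_gaussian_channel hUg.aemeasurable hNg.aemeasurable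
      hUlaw (hN n).map_eq hv hUN, ← ENNReal.ofReal_div_of_pos hlog2, Real.logb, mul_div_assoc]
  have hrate : 1 / (2 * L) * Real.logb 2 g = 1 / 2 * Real.logb 2 (g ^ (1 / L)) := by
    rw [Real.logb_rpow_eq_mul_logb_of_pos hg0]; field_simp
  have hT0 : 0 < g ^ (1 / L) := Real.rpow_pos_of_pos hg0 _
  have hT1 : 1 ≤ g ^ (1 / L) := Real.one_le_rpow hg1 (by positivity)
  have hle : g ^ (1 / L) ≤ 1 + s / v := le_of_mul_le_mul_left hbound (by positivity)
  rw [hinfo, hrate]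
  constructor
  · refine ENNReal.ofReal_le_ofReal ?_
    have := Real.logb_le_logb_of_le (b := 2) (by norm_num) hT0 hle
    linarith
  -- `ENNReal.ofReal` is injective only on nonnegative reals; both rates qualify because 1 + s/v and
  -- g^(1/L) are at least 1.
  · rw [ENNReal.ofReal_eq_ofReal_iff
      (mul_nonneg (by norm_num) (Real.logb_nonneg (by norm_num) hR1))
      (mul_nonneg (by norm_num) (Real.logb_nonneg (by norm_num) hT1))]
    have hiff : (1 / 2 * Real.logb 2 (1 + s / v) = 1 / 2 * Real.logb 2 (g ^ (1 / L))) ↔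
        2 * Real.pi * g ^ (1 / L) = 2 * Real.pi * (1 + s / v : ℝ) := by
      rw [mul_right_inj' (by norm_num), mul_right_inj' (by positivity), eq_comm]
      exact (Real.logb_injOn_pos (by norm_num)).eq_iff hT0 (by exact zero_lt_one.trans_le hR1)
    rw [hiff, heq]
    -- Only the spectral condition has content: the first formula for v is the distortion identity,
    -- and the second follows from it once |1 - C|² is constant on a band of length 2π/L.
    refine ⟨fun h => ⟨h, ?_, ?_⟩, fun h => h.1⟩
    · have hI0 : 1 / (2 * Real.pi) * I ≠ 0 := by
        intro h0; rw [h0] at hmse; simp at hmse; linarith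
      rw [eq_div_iff hI0, ← hmse]
    · have hIval : I = 2 * Real.pi / L * g ^ (-(L - 1) / L) := by
        rw [hI, intervalIntegral.integral_of_le (by have : 0 < Real.pi / L := by positivity
                                                    linarith)]
        have h2 := ae_restrict_of_ae_restrict_of_subset (SigmaDelta.band_subset hL) h
        have h3 : ∫ w in Set.Ioc (-(Real.pi / L)) (Real.pi / L), ‖1 - C w‖ ^ 2 =
            ∫ w in Set.Ioc (-(Real.pi / L)) (Real.pi / L), g ^ (-(L - 1) / L) := by
          refine integral_congr_ae ?_
          filter_upwards [h2, ae_restrict_mem measurableSet_Ioc] with w hw hmem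
          exact hw.1 (Set.Ioc_subset_Icc_self hmem)
        rw [h3, ← intervalIntegral.integral_of_le (by have : 0 < Real.pi / L := by positivity
                                                      linarith),
          intervalIntegral.integral_const, smul_eq_mul]
        ring
      have hα : 0 < g ^ (-(L - 1) / L) := Real.rpow_pos_of_pos hg0 _
      rw [eq_div_iff hα.ne', hmse, hIval]
      field_simp
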